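/- Let $n\ge 3$ and let $(M,g_{ab})$ be a spacetime: an $n$-dimensional smooth, Hausdorff, paracompact, connected, orientable manifold with a smooth Lorentzian metric of signature $(+,-,\dots,-)$ and a chosen time orientation. Suppose that $(M,g_{ab})$ is of class A, that is: 1. The Einstein equations $R_{ab}-\tfrac12 g_{ab}R+\widetilde\Lambda g_{ab}=8\pi T_{ab}$ hold with some cosmological constant $\widetilde\Lambda\in\mathbb R$, and the energy-momentum tensor $T_{ab}$ satisfies the dominant energy condition: for each future directed timelike vector $\xi^a$, the vector ${T^a}_b\xi^b$ is zero or future directed timelike or null. 2. There is a smooth (global) one-parameter group $\chi_u$, $u\in\mathbb R$, of isometries of $(M,g_{ab})$, generated by a Killing vector field $\mathfrak K^a$, and it admits a connected Killing horizon $\mathcal N$: a smooth embedded null hypersurface of $M$ that is invariant under $\chi_u$ and on which $\mathfrak K^a$ is null. Moreover $\mathfrak K^a$ is future directed on $\mathcal N$, and $\chi_u$ has no fixed point on $\mathcal N$. 3. $\mathcal N$ has a smooth global cross-section $\mathcal Z$, a compact orientable $(n-2)$-dimensional manifold without boundary: the orbits of $\chi_u$ on $\mathcal N$ are diffeomorphic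 to $\mathbb R$, each meets $\mathcal Z$ precisely once, and $(u,z)\mapsto\chi_u(z)$ is a diffeomorphism $\mathbb R\times\mathcal Z\to\mathcal N$. Then there is exactly one function $\kappa_\circ:\mathcal N\to\mathbb R$ (the surface gravity) with $$\tfrac12\nabla^a(\mathfrak K^e\mathfrak K_e)=-\kappa_\circ\,\mathfrak K^a\quad\text{on }\mathcal N,$$ and $\kappa_\circ$ is constant throughout $\mathcal N$ (the zeroth law). Moreover, ${T^a}_b\mathfrak K^b$ points in the direction of $\mathfrak K^a$ on $\mathcal N$: at each point of $\mathcal N$ there is a number $\varphi\ge 0$ with ${T^a}_b\mathfrak K^b=\varphi\,\mathfrak K^a$. -/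

import Mathlib

open scoped Manifold ContDiff Bundle
open Set

noncomputable section

/-- An `n`-dimensional smooth manifold is orientable if it can be covered by smooth charts all of
whose transition maps have positive Jacobian determinant. -/
def OrientableManifold (n : ℕ) (M : Type*) [TopologicalSpace M]
    [ChartedSpace (EuclideanSpace ℝ (Fin n)) M] : Prop :=
  ∃ A ⊆ IsManifold.maximalAtlas (𝓡 n) ∞ M,
    (∀ p : M, ∃ e ∈ A, p ∈ e.source) ∧
    ∀ e ∈ A, ∀ e' ∈ A, ∀ y ∈ (e.symm ≫ₕ e').source,
      0 < (fderiv ℝ (e.symm ≫ₕ e') y).det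

/-- A smooth Lorentzian metric of signature `(+,-,…,-)`. -/
structure LorentzMetric (n : ℕ) (M : Type*) [TopologicalSpace M]
    [ChartedSpace (EuclideanSpace ℝ (Fin n)) M] [IsManifold (𝓡 n) ∞ M] where
  /-- The bilinear form `g_{ab}` on each tangent space. -/
  val (p : M) : TangentSpace (𝓡 n) p →L[ℝ] TangentSpace (𝓡 n) p →L[ℝ] ℝ
  symm (p : M) (v w : TangentSpace (𝓡 n) p) : val p v w = val p w v
  /-- Signature `(+,-,…,-)`: some vector has positive square, and the form is negative definite
  on its orthogonal complement. -/
  signature (p : M) : ∃ v : TangentSpace (𝓡 n) p, 0 < val p v v ∧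
    ∀ w : TangentSpace (𝓡 n) p, val p v w = 0 → w ≠ 0 → val p w w < 0
  smooth : ContMDiff (𝓡 n)
    ((𝓡 n).prod 𝓘(ℝ, EuclideanSpace ℝ (Fin n) →L[ℝ] EuclideanSpace ℝ (Fin n) →L[ℝ] ℝ)) ∞
    (fun p ↦ Bundle.TotalSpace.mk'
      (EuclideanSpace ℝ (Fin n) →L[ℝ] EuclideanSpace ℝ (Fin n) →L[ℝ] ℝ)
      (E := fun p : M ↦ TangentSpace (𝓡 n) p →L[ℝ] TangentSpace (𝓡 n) p →L[ℝ] ℝ) p (val p))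

namespace LorentzMetric

variable {n : ℕ} {M : Type*} [TopologicalSpace M]
    [ChartedSpace (EuclideanSpace ℝ (Fin n)) M] [IsManifold (𝓡 n) ∞ M]

theorem eq_zero_of_forall (g : LorentzMetric n M) (p : M) (v : TangentSpace (𝓡 n) p)
    (h : ∀ w, g.val p v w = 0) : v = 0 := by
  obtain ⟨t, -, ht⟩ := g.signature p
  by_contra hv
  have h1 := ht v (by rw [g.symm, h]) hv
  rw [h v] at h1
  exact lt_irrefl _ h1

/-- Lowering an index, `v ↦ g_{ab} v^a`, is bijective. -/
theorem lower_bijective (g : LorentzMetric n M) (p : M) : Function.Bijective (g.val p) := by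
  have : FiniteDimensional ℝ (TangentSpace (𝓡 n) p) :=
    inferInstanceAs (FiniteDimensional ℝ (EuclideanSpace ℝ (Fin n)))
  have : T2Space (TangentSpace (𝓡 n) p) :=
    inferInstanceAs (T2Space (EuclideanSpace ℝ (Fin n)))
  have hinj : Function.Injective (g.val p).toLinearMap := by
    rw [← LinearMap.ker_eq_bot, LinearMap.ker_eq_bot']
    intro v hv
    exact g.eq_zero_of_forall p v (fun w ↦ congrArg (fun l ↦ l w) hv)
  have hdim : Module.finrank ℝ (TangentSpace (𝓡 n) p) =
      Module.finrank ℝ (TangentSpace (𝓡 n) p →L[ℝ] ℝ) := by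
    rw [← (LinearMap.toContinuousLinearMap :
      (TangentSpace (𝓡 n) p →ₗ[ℝ] ℝ) ≃ₗ[ℝ] _).finrank_eq]
    exact Subspace.dual_finrank_eq.symm
  exact ⟨hinj, (LinearMap.injective_iff_surjective_of_finrank_eq_finrank hdim).1 hinj⟩

/-- Raising an index: `α_b ↦ g^{ab} α_b`. -/
def raise (g : LorentzMetric n M) (p : M) (α : TangentSpace (𝓡 n) p →L[ℝ] ℝ) :
    TangentSpace (𝓡 n) p :=
  (Equiv.ofBijective _ (g.lower_bijective p)).symm α

theorem val_raise (g : LorentzMetric n M) (p : M) (α : TangentSpace (𝓡 n) p →L[ℝ] ℝ)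
    (w : TangentSpace (𝓡 n) p) : g.val p (g.raise p α) w = α w :=
  congrArg (fun l ↦ l w) ((Equiv.ofBijective _ (g.lower_bijective p)).apply_symm_apply α)

/-- The gradient `∇^a f` of a scalar function. -/
def grad (g : LorentzMetric n M) (f : M → ℝ) (p : M) : TangentSpace (𝓡 n) p :=
  g.raise p (mvfderiv (𝓡 n) f p)

end LorentzMetric

section Coordinates

variable {n : ℕ} {M : Type*} [TopologicalSpace M]
    [ChartedSpace (EuclideanSpace ℝ (Fin n)) M]

/-- The coordinate basis vector `∂/∂x^i` of the chart `φ`, at the point with coordinates `y`. -/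
def coordVector (φ : OpenPartialHomeomorph M (EuclideanSpace ℝ (Fin n))) (i : Fin n)
    (y : EuclideanSpace ℝ (Fin n)) : TangentSpace (𝓡 n) (φ.symm y) :=
  mfderiv (𝓡 n) (𝓡 n) φ.symm y (EuclideanSpace.single i (1 : ℝ))

/-- The components `B_{ij}` of a field of bilinear forms in the chart `φ`, as functions of the
coordinates. -/
def components (B : ∀ p : M, TangentSpace (𝓡 n) p →L[ℝ] TangentSpace (𝓡 n) p →L[ℝ] ℝ)
    (φ : OpenPartialHomeomorph M (EuclideanSpace ℝ (Fin n))) (i j : Fin n)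
    (y : EuclideanSpace ℝ (Fin n)) : ℝ :=
  B (φ.symm y) (coordVector φ i y) (coordVector φ j y)

/-- The partial derivative `∂_k f` of a function of the coordinates. -/
def partialDeriv (k : Fin n) (f : EuclideanSpace ℝ (Fin n) → ℝ)
    (y : EuclideanSpace ℝ (Fin n)) : ℝ :=
  fderiv ℝ f y (EuclideanSpace.single k (1 : ℝ))

end Coordinates

namespace LorentzMetric

variable {n : ℕ} {M : Type*} [TopologicalSpace M]
    [ChartedSpace (EuclideanSpace ℝ (Fin n)) M] [IsManifold (𝓡 n) ∞ M]

/-- The components `g^{ij}` of the inverse metric in the chart `φ`. -/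
def inverseComponents (g : LorentzMetric n M)
    (φ : OpenPartialHomeomorph M (EuclideanSpace ℝ (Fin n))) (i j : Fin n)
    (y : EuclideanSpace ℝ (Fin n)) : ℝ :=
  (Matrix.of fun a b ↦ components g.val φ a b y)⁻¹ i j

/-- The Christoffel symbols
`Γ^k_{ij} = ½ g^{kl} (∂_i g_{jl} + ∂_j g_{il} - ∂_l g_{ij})` in the chart `φ`. -/
def christoffel (g : LorentzMetric n M)
    (φ : OpenPartialHomeomorph M (EuclideanSpace ℝ (Fin n))) (k i j : Fin n)
    (y : EuclideanSpace ℝ (Fin n)) : ℝ :=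
  (1 / 2) * ∑ l, g.inverseComponents φ k l y *
    (partialDeriv i (components g.val φ j l) y + partialDeriv j (components g.val φ i l) y
      - partialDeriv l (components g.val φ i j) y)

/-- The components of the Ricci tensor in the chart `φ`,
`R_{ij} = ∂_k Γ^k_{ij} - ∂_j Γ^k_{ik} + Γ^k_{kl} Γ^l_{ij} - Γ^k_{jl} Γ^l_{ik}`
(round spheres with their positive definite metrics have positive Ricci tensor). -/
def ricci (g : LorentzMetric n M)
    (φ : OpenPartialHomeomorph M (EuclideanSpace ℝ (Fin n))) (i j : Fin n)
    (y : EuclideanSpace ℝ (Fin n)) : ℝ :=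
  ∑ k, (partialDeriv k (g.christoffel φ k i j) y - partialDeriv j (g.christoffel φ k i k) y) +
    ∑ k, ∑ l, (g.christoffel φ k k l y * g.christoffel φ l i j y
      - g.christoffel φ k j l y * g.christoffel φ l i k y)

/-- The scalar curvature `R = g^{ij} R_{ij}`, computed in the chart `φ`. -/
def scalarCurvature (g : LorentzMetric n M)
    (φ : OpenPartialHomeomorph M (EuclideanSpace ℝ (Fin n)))
    (y : EuclideanSpace ℝ (Fin n)) : ℝ :=
  ∑ i, ∑ j, g.inverseComponents φ i j y * g.ricci φ i j y

/-- The Einstein equations `R_{ab} - ½ g_{ab} R + Λ g_{ab} = 8π T_{ab}`, holding in every smooth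
local coordinate system. -/
def EinsteinEquations (g : LorentzMetric n M) (Λ : ℝ)
    (T : ∀ p : M, TangentSpace (𝓡 n) p →L[ℝ] TangentSpace (𝓡 n) p →L[ℝ] ℝ) : Prop :=
  ∀ φ ∈ IsManifold.maximalAtlas (𝓡 n) ∞ M, ∀ y ∈ φ.target, ∀ i j : Fin n,
    g.ricci φ i j y - (1 / 2) * components g.val φ i j y * g.scalarCurvature φ y
      + Λ * components g.val φ i j y = 8 * Real.pi * components T φ i j y

/-- `N` is a smooth (embedded) null hypersurface: near each of its points it is the zero set of a
smooth function with nowhere vanishing differential on `N`, whose gradient, the normal of `N`, is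
null on `N`. -/
def IsNullHypersurface (g : LorentzMetric n M) (N : Set M) : Prop :=
  ∀ p ∈ N, ∃ (U : Set M) (f : M → ℝ), IsOpen U ∧ p ∈ U ∧ ContMDiffOn (𝓡 n) 𝓘(ℝ, ℝ) ∞ f U ∧
    N ∩ U = {q ∈ U | f q = 0} ∧
    ∀ q ∈ N ∩ U, mvfderiv (𝓡 n) f q ≠ 0 ∧ g.val q (g.grad f q) (g.grad f q) = 0

end LorentzMetric

/-- A smooth orientable manifold with a Lorentzian metric and a time orientation, the latter given
by a continuous timelike vector field. -/
structure Spacetime (n : ℕ) (M : Type*) [TopologicalSpace M]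
    [ChartedSpace (EuclideanSpace ℝ (Fin n)) M] [IsManifold (𝓡 n) ∞ M] where
  orientable : OrientableManifold n M
  g : LorentzMetric n M
  timeField (p : M) : TangentSpace (𝓡 n) p
  timeField_continuous : Continuous fun p ↦ (⟨p, timeField p⟩ : TangentBundle (𝓡 n) M)
  timeField_timelike (p : M) : 0 < g.val p (timeField p) (timeField p)

namespace Spacetime

variable {n : ℕ} {M : Type*} [TopologicalSpace M]
    [ChartedSpace (EuclideanSpace ℝ (Fin n)) M] [IsManifold (𝓡 n) ∞ M]

/-- `v` is a future directed timelike vector. -/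
def IsFutureTimelike (S : Spacetime n M) (p : M) (v : TangentSpace (𝓡 n) p) : Prop :=
  0 < S.g.val p v v ∧ 0 < S.g.val p (S.timeField p) v

/-- `v` is a future directed (nonzero) timelike or null vector. -/
def IsFutureCausal (S : Spacetime n M) (p : M) (v : TangentSpace (𝓡 n) p) : Prop :=
  v ≠ 0 ∧ 0 ≤ S.g.val p v v ∧ 0 < S.g.val p (S.timeField p) v

/-- The vector `T^a_b ξ^b = g^{ac} T_{cb} ξ^b`. -/
def contract (S : Spacetime n M)
    (T : ∀ p : M, TangentSpace (𝓡 n) p →L[ℝ] TangentSpace (𝓡 n) p →L[ℝ] ℝ)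
    (p : M) (ξ : TangentSpace (𝓡 n) p) : TangentSpace (𝓡 n) p :=
  S.g.raise p
    { toFun := fun w ↦ T p w ξ
      map_add' := by simp
      map_smul' := by simp
      cont := ((ContinuousEvalConst.continuous_eval_const ξ).comp (T p).continuous) }

/-- The dominant energy condition: `T^a_b ξ^b` is future directed timelike or null (or zero, as
in vacuum) for each future directed timelike `ξ^a`. -/
def DominantEnergyCondition (S : Spacetime n M)
    (T : ∀ p : M, TangentSpace (𝓡 n) p →L[ℝ] TangentSpace (𝓡 n) p →L[ℝ] ℝ) : Prop :=
  ∀ (p : M) (ξ : TangentSpace (𝓡 n) p), S.IsFutureTimelike p ξ →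
    S.contract T p ξ = 0 ∨ S.IsFutureCausal p (S.contract T p ξ)

/-- The data and conditions that make a spacetime one of class A. The type `Z` is the abstract
global cross-section of the Killing horizon `N`. -/
structure ClassA (S : Spacetime n M) (Z : Type*) [TopologicalSpace Z]
    [ChartedSpace (EuclideanSpace ℝ (Fin (n - 2))) Z] [IsManifold (𝓡 (n - 2)) ∞ Z] where
  /-- The cosmological constant. -/
  Λ : ℝ
  /-- The energy-momentum tensor `T_{ab}`. -/
  T (p : M) : TangentSpace (𝓡 n) p →L[ℝ] TangentSpace (𝓡 n) p →L[ℝ] ℝ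
  einstein : S.g.EinsteinEquations Λ T
  dominantEnergy : S.DominantEnergyCondition T
  /-- The one-parameter group `χ_u` of isometries. -/
  χ : ℝ → M → M
  χ_smooth : ContMDiff (𝓘(ℝ, ℝ).prod (𝓡 n)) (𝓡 n) ∞ (fun q : ℝ × M ↦ χ q.1 q.2)
  χ_zero (p : M) : χ 0 p = p
  χ_add (u v : ℝ) (p : M) : χ (u + v) p = χ u (χ v p)
  χ_isometry (u : ℝ) (p : M) (v w : TangentSpace (𝓡 n) p) :
    S.g.val (χ u p) (mfderiv (𝓡 n) (𝓡 n) (χ u) p v) (mfderiv (𝓡 n) (𝓡 n) (χ u) p w)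
      = S.g.val p v w
  /-- The Killing vector field that generates `χ_u`. -/
  K (p : M) : TangentSpace (𝓡 n) p
  K_smooth : ContMDiff (𝓡 n) (𝓡 n).tangent ∞
    (fun p ↦ (⟨p, K p⟩ : TangentBundle (𝓡 n) M))
  K_generates (p : M) : IsMIntegralCurve (I := 𝓡 n) (fun u ↦ χ u p) K
  /-- The Killing horizon. -/
  N : Set M
  N_connected : IsConnected N
  N_null : S.g.IsNullHypersurface N
  N_invariant (u : ℝ) : MapsTo (χ u) N N
  K_null : ∀ p ∈ N, S.g.val p (K p) (K p) = 0
  K_future : ∀ p ∈ N, S.IsFutureCausal p (K p)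
  no_fixed_point : ∀ p ∈ N, ∀ u : ℝ, u ≠ 0 → χ u p ≠ p
  /-- The global cross-section is compact, orientable, and embedded in `N` by `ι`; moving it by
  `χ_u` identifies `ℝ × Z` with `N`, so each orbit of `χ_u` in `N` is a line that meets the
  cross-section exactly once. -/
  ι : Z → M
  Z_compact : CompactSpace Z
  Z_orientable : OrientableManifold (n - 2) Z
  Z_section : Manifold.IsSmoothEmbedding (𝓘(ℝ, ℝ).prod (𝓡 (n - 2))) (𝓡 n) ∞
    (fun q : ℝ × Z ↦ χ q.1 (ι q.2))
  Z_range : range (fun q : ℝ × Z ↦ χ q.1 (ι q.2)) = N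

/-- `κ : N → ℝ` is the surface gravity: `½ ∇^a (K^e K_e) = - κ K^a` on `N`. -/
def ClassA.IsSurfaceGravity {S : Spacetime n M} {Z : Type*} [TopologicalSpace Z]
    [ChartedSpace (EuclideanSpace ℝ (Fin (n - 2))) Z] [IsManifold (𝓡 (n - 2)) ∞ Z]
    (A : S.ClassA Z) (κ : A.N → ℝ) : Prop :=
  ∀ p : A.N, (1 / 2 : ℝ) • S.g.grad (fun q ↦ S.g.val q (A.K q) (A.K q)) p = -(κ p • A.K p)

end Spacetime

end

/-! Everything is local until the very end. Near a point of the horizon `exists_isHorizonChart`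
provides coordinates in which the horizon is `x^r = 0` and the Killing field is `∂/∂x^a` with `a ≠
r`. Invariance under the flow gives `∂_a g_{ij} = 0`. Being null and tangent to a null hypersurface,
the Killing field is normal to it, so `g_{aj} = 0` on the horizon for all `j ≠ r`. Two facts follow
there: the surface gravity is `Γ^a_{aa}` (`half_grad_norm_K`), and `R_{aj} = -∂_j Γ^a_{aa}` for `j ≠
r` (`AdaptedIn.ricci_eq`).

The field equations are then used twice, and each time the terms with the scalar curvature and the
cosmological constant drop out because they multiply a vanishing `g_{aj}`. With `j = a`, invariance
gives `R_{aa} = 0`, so `T_{aa} = 0`. The dominant energy condition now makes `T^a_b K^b` a causal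
limit vector (or zero) orthogonal to the null vector `K`, hence a nonnegative multiple of `K`
(`DominantEnergyCondition.contract_eq_smul`). With `j ≠ r`, this proportionality gives `T_{ja} = 0`,
so `R_{aj} = 0`, and all tangential derivatives of the surface gravity vanish. It is therefore
locally constant, and constant since the horizon is connected. -/

/-! ### Lorentzian linear algebra -/

namespace LorentzMetric

variable {n : ℕ} {M : Type*} [TopologicalSpace M]
    [ChartedSpace (EuclideanSpace ℝ (Fin n)) M] [IsManifold (𝓡 n) ∞ M]

/-- A causal vector orthogonal to a nonzero null vector is proportional to it. -/
theorem exists_smul_of_orthogonal_null (g : LorentzMetric n M) {p : M}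
    {k v : TangentSpace (𝓡 n) p} (hk0 : k ≠ 0) (hk : g.val p k k = 0)
    (hv : 0 ≤ g.val p v v) (hkv : g.val p k v = 0) : ∃ c : ℝ, v = c • k := by
  obtain ⟨t, -, ht⟩ := g.signature p
  have htk : g.val p t k ≠ 0 := fun h ↦ by
    have := ht k h hk0
    linarith
  -- This factor makes `v - c • k` orthogonal to the timelike `t`, where the form is negative
  -- definite. But the square of `v - c • k` equals that of `v`, which is nonnegative.
  refine ⟨g.val p t v / g.val p t k, ?_⟩
  set c := g.val p t v / g.val p t k with hc
  by_contra hne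
  have h1 := ht (v - c • k) (by
    rw [map_sub, map_smul, smul_eq_mul, hc]; field_simp; ring) (sub_ne_zero.2 hne)
  have hvk : g.val p v k = 0 := by rw [g.symm, hkv]
  simp only [map_sub, map_smul, sub_apply, smul_apply,
    smul_eq_mul, hk, hkv, hvk] at h1
  linarith

end LorentzMetric

namespace Spacetime

variable {n : ℕ} {M : Type*} [TopologicalSpace M]
    [ChartedSpace (EuclideanSpace ℝ (Fin n)) M] [IsManifold (𝓡 n) ∞ M]

theorem val_contract (S : Spacetime n M)
    (T : ∀ p : M, TangentSpace (𝓡 n) p →L[ℝ] TangentSpace (𝓡 n) p →L[ℝ] ℝ)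
    (p : M) (ξ w : TangentSpace (𝓡 n) p) : S.g.val p (S.contract T p ξ) w = T p w ξ :=
  S.g.val_raise p _ w

theorem contract_add_smul (S : Spacetime n M)
    (T : ∀ p : M, TangentSpace (𝓡 n) p →L[ℝ] TangentSpace (𝓡 n) p →L[ℝ] ℝ)
    (p : M) (ξ η : TangentSpace (𝓡 n) p) (c : ℝ) :
    S.contract T p (ξ + c • η) = S.contract T p ξ + c • S.contract T p η := by
  apply (S.g.lower_bijective p).1
  ext w
  simp only [map_add, map_smul, add_apply, smul_apply,
    val_contract]

/-- Under the dominant energy condition, `T^a_b k^b` is a nonnegative multiple of the future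
directed null vector `k^a` as soon as `T_{ab} k^a k^b = 0`. -/
theorem DominantEnergyCondition.contract_eq_smul {S : Spacetime n M}
    {T : ∀ p : M, TangentSpace (𝓡 n) p →L[ℝ] TangentSpace (𝓡 n) p →L[ℝ] ℝ}
    (hT : S.DominantEnergyCondition T) {p : M} {k : TangentSpace (𝓡 n) p}
    (hk : S.IsFutureCausal p k) (hk0 : S.g.val p k k = 0) (hTk : T p k k = 0) :
    ∃ φ : ℝ, 0 ≤ φ ∧ S.contract T p k = φ • k := by
  obtain ⟨hkne, -, hkt⟩ := hk
  set t := S.timeField p with ht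
  have htt : 0 < S.g.val p t t := S.timeField_timelike p
  set v := S.contract T p k with hv
  set w := S.contract T p t with hw
  have hkt' : 0 < S.g.val p k t := by rwa [S.g.symm]
  -- The energy condition speaks only of timelike vectors, so the null `k` is approached by the
  -- timelike `k + ε • t`; the closed inequalities survive the limit `ε → 0+`.
  have key : ∀ ε : ℝ, 0 < ε → 0 ≤ S.g.val p (v + ε • w) (v + ε • w) ∧
      0 ≤ S.g.val p t (v + ε • w) := by
    intro ε hε
    have hfut : S.IsFutureTimelike p (k + ε • t) := by
      constructor
      · simp only [map_add, map_smul, add_apply,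
          smul_apply, smul_eq_mul, hk0]
        positivity
      · rw [← ht, map_add, map_smul, smul_eq_mul]
        positivity
    rw [hv, hw, ← contract_add_smul]
    rcases hT p _ hfut with h0 | h0
    · rw [h0]; simp
    · exact ⟨h0.2.1, h0.2.2.le⟩
  have hvv : 0 ≤ S.g.val p v v := by
    have hc : Continuous fun ε : ℝ ↦ S.g.val p v v + ε * S.g.val p v w + ε * S.g.val p w v
        + ε * ε * S.g.val p w w := by fun_prop
    have hlim := (hc.tendsto 0).mono_left (nhdsWithin_le_nhds (s := Ioi 0))
    simp only [zero_mul, add_zero] at hlim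
    refine ge_of_tendsto hlim ?_
    filter_upwards [self_mem_nhdsWithin] with ε hε
    have := (key ε hε).1
    simp only [map_add, map_smul, add_apply,
      smul_apply, smul_eq_mul] at this
    linarith
  have htv : 0 ≤ S.g.val p t v := by
    have hc : Continuous fun ε : ℝ ↦ S.g.val p t v + ε * S.g.val p t w := by fun_prop
    have hlim := (hc.tendsto 0).mono_left (nhdsWithin_le_nhds (s := Ioi 0))
    simp only [zero_mul, add_zero] at hlim
    refine ge_of_tendsto hlim ?_
    filter_upwards [self_mem_nhdsWithin] with ε hε
    have := (key ε hε).2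
    simpa only [map_add, map_smul, smul_eq_mul] using this
  -- `T_{ab} k^a k^b = 0` says precisely that `v` is orthogonal to `k`.
  have hkv : S.g.val p k v = 0 := by rw [S.g.symm, hv, val_contract, hTk]
  obtain ⟨c, hc⟩ := S.g.exists_smul_of_orthogonal_null hkne hk0 hvv hkv
  refine ⟨c, ?_, hc⟩
  rw [hc, map_smul, smul_eq_mul] at htv
  exact nonneg_of_mul_nonneg_left htv hkt

end Spacetime

/-! ### Partial derivatives -/

section PartialDeriv

variable {n : ℕ} {F H : EuclideanSpace ℝ (Fin n) → ℝ} {y : EuclideanSpace ℝ (Fin n)}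

theorem partialDeriv_const_mul (k : Fin n) (c : ℝ) (hF : DifferentiableAt ℝ F y) :
    partialDeriv k (fun x ↦ c * F x) y = c * partialDeriv k F y := by
  simp [partialDeriv, fderiv_const_mul hF]

theorem partialDeriv_mul (k : Fin n) (hF : DifferentiableAt ℝ F y)
    (hH : DifferentiableAt ℝ H y) :
    partialDeriv k (fun x ↦ F x * H x) y =
      F y * partialDeriv k H y + partialDeriv k F y * H y := by
  simp [partialDeriv, fderiv_fun_mul hF hH, mul_comm]

theorem partialDeriv_sum {ι : Type*} (s : Finset ι) (k : Fin n)
    {f : ι → EuclideanSpace ℝ (Fin n) → ℝ} (hf : ∀ i ∈ s, DifferentiableAt ℝ (f i) y) :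
    partialDeriv k (fun x ↦ ∑ i ∈ s, f i x) y = ∑ i ∈ s, partialDeriv k (f i) y := by
  simp [partialDeriv, fderiv_fun_sum hf]

theorem partialDeriv_congr_of_eqOn (k : Fin n) {V : Set (EuclideanSpace ℝ (Fin n))}
    (hV : IsOpen V) (h : ∀ x ∈ V, F x = H x) (hy : y ∈ V) :
    partialDeriv k F y = partialDeriv k H y := by
  have : F =ᶠ[nhds y] H := Filter.eventuallyEq_of_mem (hV.mem_nhds hy) h
  rw [partialDeriv, partialDeriv, this.fderiv_eq]

theorem hasDerivAt_line (hF : DifferentiableAt ℝ F y) (k : Fin n) :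
    HasDerivAt (fun t : ℝ ↦ F (y + t • EuclideanSpace.single k (1 : ℝ))) (partialDeriv k F y) 0 := by
  have h1 : HasDerivAt (fun t : ℝ ↦ y + t • EuclideanSpace.single k (1 : ℝ))
      (EuclideanSpace.single k (1 : ℝ)) 0 := by
    simpa using ((hasDerivAt_id (0 : ℝ)).smul_const (EuclideanSpace.single k (1 : ℝ))).const_add y
  have h2 : HasFDerivAt F (fderiv ℝ F y) (y + (0 : ℝ) • EuclideanSpace.single k (1 : ℝ)) := by
    simpa using hF.hasFDerivAt
  exact h2.comp_hasDerivAt _ h1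

theorem eventually_line_mem {V : Set (EuclideanSpace ℝ (Fin n))} (hV : IsOpen V) (hy : y ∈ V)
    (k : Fin n) : ∀ᶠ t : ℝ in nhds 0, y + t • EuclideanSpace.single k (1 : ℝ) ∈ V := by
  have hc : Continuous fun t : ℝ ↦ y + t • EuclideanSpace.single k (1 : ℝ) := by fun_prop
  exact hc.continuousAt.eventually_mem (hV.mem_nhds (by simpa using hy))

/-- Two functions that agree on the hyperplane `x_r = 0` have the same tangential partial
derivatives there. -/
theorem partialDeriv_congr_of_eqOn_hyperplane {r j : Fin n} (hj : j ≠ r)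
    {V : Set (EuclideanSpace ℝ (Fin n))} (hV : IsOpen V)
    (h : ∀ x ∈ V, x r = 0 → F x = H x) (hy : y ∈ V) (hyr : y r = 0)
    (hF : DifferentiableAt ℝ F y) (hH : DifferentiableAt ℝ H y) :
    partialDeriv j F y = partialDeriv j H y := by
  have hF' := hasDerivAt_line hF j
  have hH' := hasDerivAt_line hH j
  refine hF'.unique (hH'.congr_of_eventuallyEq ?_)
  filter_upwards [eventually_line_mem hV hy j] with t ht
  exact h _ ht (by simp [hyr, hj.symm])

theorem partialDeriv_const (k : Fin n) (c : ℝ) :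
    partialDeriv k (fun _ : EuclideanSpace ℝ (Fin n) ↦ c) y = 0 := by
  simp [partialDeriv]

theorem contDiffOn_partialDeriv {V : Set (EuclideanSpace ℝ (Fin n))} (hV : IsOpen V)
    (hF : ContDiffOn ℝ ∞ F V) (k : Fin n) : ContDiffOn ℝ ∞ (partialDeriv k F) V :=
  (hF.fderiv_of_isOpen hV (m := ∞) (by simp)).clm_apply contDiffOn_const

theorem partialDeriv_comm {V : Set (EuclideanSpace ℝ (Fin n))} (hV : IsOpen V)
    (hF : ContDiffOn ℝ ∞ F V) (hy : y ∈ V) (i j : Fin n) :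
    partialDeriv i (partialDeriv j F) y = partialDeriv j (partialDeriv i F) y := by
  have hd : DifferentiableAt ℝ (fderiv ℝ F) y :=
    ((hF.fderiv_of_isOpen hV (m := ∞) (by simp)).contDiffAt (hV.mem_nhds hy)).differentiableAt
      (by simp)
  have hs : IsSymmSndFDerivAt ℝ F y :=
    (hF.contDiffAt (hV.mem_nhds hy)).isSymmSndFDerivAt (by
      simpa using WithTop.coe_le_coe.2 (le_top (a := (2 : ℕ∞))))
  have key : ∀ i j : Fin n, partialDeriv i (partialDeriv j F) y =
      fderiv ℝ (fderiv ℝ F) y (EuclideanSpace.single i 1) (EuclideanSpace.single j 1) := by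
    intro i j
    change fderiv ℝ (fun x ↦ fderiv ℝ F x (EuclideanSpace.single j (1 : ℝ))) y _ = _
    rw [fderiv_clm_apply hd (differentiableAt_const _)]
    simp
  rw [key, key, hs.eq]

end PartialDeriv

/-! ### The Ricci tensor in coordinates adapted to a Killing horizon -/

section MatrixSmooth

variable {E : Type*} [NormedAddCommGroup E] [NormedSpace ℝ E] {m : ℕ} {V : Set E}

theorem contDiffOn_matrix_det {A : E → Matrix (Fin m) (Fin m) ℝ}
    (hA : ∀ i j, ContDiffOn ℝ ∞ (fun x ↦ A x i j) V) :
    ContDiffOn ℝ ∞ (fun x ↦ (A x).det) V := by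
  simp only [Matrix.det_apply]
  refine ContDiffOn.sum fun σ _ ↦ ContDiffOn.const_smul _ ?_
  exact contDiffOn_prod fun i _ ↦ hA _ _

theorem contDiffOn_matrix_inv {A : E → Matrix (Fin m) (Fin m) ℝ}
    (hA : ∀ i j, ContDiffOn ℝ ∞ (fun x ↦ A x i j) V) (hdet : ∀ x ∈ V, (A x).det ≠ 0)
    (i j : Fin m) : ContDiffOn ℝ ∞ (fun x ↦ (A x)⁻¹ i j) V := by
  simp only [Matrix.inv_def, Matrix.smul_apply, smul_eq_mul, Ring.inverse_eq_inv',
    Matrix.adjugate_apply]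
  refine ((contDiffOn_matrix_det hA).inv hdet).mul (contDiffOn_matrix_det fun k l ↦ ?_)
  by_cases hk : k = j
  · subst hk
    simpa using contDiffOn_const
  · simpa [Matrix.updateRow_ne hk] using hA k l

end MatrixSmooth

namespace LorentzMetric

variable {n : ℕ} {M : Type*} [TopologicalSpace M]
    [ChartedSpace (EuclideanSpace ℝ (Fin n)) M] [IsManifold (𝓡 n) ∞ M]
    (g : LorentzMetric n M) (φ : OpenPartialHomeomorph M (EuclideanSpace ℝ (Fin n)))

theorem differentiableAt_of_mem_target {M : Type*} [TopologicalSpace M]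
    {φ : OpenPartialHomeomorph M (EuclideanSpace ℝ (Fin n))}
    {F : EuclideanSpace ℝ (Fin n) → ℝ} (hF : ContDiffOn ℝ ∞ F φ.target)
    {y : EuclideanSpace ℝ (Fin n)} (hy : y ∈ φ.target) : DifferentiableAt ℝ F y :=
  (hF.contDiffAt (φ.open_target.mem_nhds hy)).differentiableAt (by simp)

/-- The metric has smooth components with invertible matrix in the chart `φ`. -/
structure RegularIn : Prop where
  smooth (i j : Fin n) : ContDiffOn ℝ ∞ (components g.val φ i j) φ.target
  det_ne_zero : ∀ y ∈ φ.target, (Matrix.of fun a b ↦ components g.val φ a b y).det ≠ 0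

/-- The chart `φ` is adapted to a Killing field `∂/∂x^a` and its horizon `x^r = 0`: the components
of the metric do not depend on `x^a`, and `∂/∂x^a` is normal to the horizon. -/
structure AdaptedIn (a r : Fin n) : Prop extends g.RegularIn φ where
  ne : a ≠ r
  partialDeriv_eq_zero : ∀ y ∈ φ.target, ∀ i j, partialDeriv a (components g.val φ i j) y = 0
  normal : ∀ y ∈ φ.target, y r = 0 → ∀ j, j ≠ r → components g.val φ a j y = 0

variable {g φ}

theorem components_comm (g : LorentzMetric n M)
    (φ : OpenPartialHomeomorph M (EuclideanSpace ℝ (Fin n))) (i j : Fin n) :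
    components g.val φ i j = components g.val φ j i :=
  funext fun _ ↦ g.symm _ _ _

theorem inverseComponents_comm (g : LorentzMetric n M)
    (φ : OpenPartialHomeomorph M (EuclideanSpace ℝ (Fin n))) (i j : Fin n)
    (y : EuclideanSpace ℝ (Fin n)) :
    g.inverseComponents φ i j y = g.inverseComponents φ j i y := by
  have h : (Matrix.of fun a b ↦ components g.val φ a b y).IsSymm := by
    ext i j
    simp [components_comm g φ i j]
  have h' := h.inv
  exact (h'.apply i j).symm

theorem christoffel_comm (g : LorentzMetric n M)
    (φ : OpenPartialHomeomorph M (EuclideanSpace ℝ (Fin n))) (k i j : Fin n) :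
    g.christoffel φ k i j = g.christoffel φ k j i := by
  funext y
  simp only [christoffel, components_comm g φ j i]
  congr 1
  exact Finset.sum_congr rfl fun l _ ↦ by ring

/-! ### Levi-Civita identities in a chart -/

namespace RegularIn

variable (h : g.RegularIn φ)
include h

theorem smooth_inverseComponents (i j : Fin n) :
    ContDiffOn ℝ ∞ (g.inverseComponents φ i j) φ.target :=
  contDiffOn_matrix_inv (A := fun y ↦ Matrix.of fun a b ↦ components g.val φ a b y)
    h.smooth h.det_ne_zero i j

theorem smooth_partialDeriv (k i j : Fin n) :
    ContDiffOn ℝ ∞ (partialDeriv k (components g.val φ i j)) φ.target :=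
  contDiffOn_partialDeriv φ.open_target (h.smooth i j) k

theorem smooth_christoffel (k i j : Fin n) :
    ContDiffOn ℝ ∞ (g.christoffel φ k i j) φ.target := by
  refine contDiffOn_const.mul (ContDiffOn.sum fun l _ ↦ ?_)
  exact (h.smooth_inverseComponents k l).mul
    (((h.smooth_partialDeriv _ _ _).add (h.smooth_partialDeriv _ _ _)).sub
      (h.smooth_partialDeriv _ _ _))

theorem sum_components_mul_inverse {y : EuclideanSpace ℝ (Fin n)} (hy : y ∈ φ.target)
    (i k : Fin n) :
    ∑ m, components g.val φ i m y * g.inverseComponents φ m k y = if i = k then 1 else 0 := by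
  have := Matrix.mul_nonsing_inv (Matrix.of fun a b ↦ components g.val φ a b y)
    (Ne.isUnit (h.det_ne_zero y hy))
  have := congrFun (congrFun this i) k
  rwa [Matrix.mul_apply, Matrix.one_apply] at this

/-- Lowering the upper index of the Christoffel symbols. -/
theorem sum_components_mul_christoffel {y : EuclideanSpace ℝ (Fin n)} (hy : y ∈ φ.target)
    (m i j : Fin n) :
    ∑ k, components g.val φ m k y * g.christoffel φ k i j y =
      (1 / 2) * (partialDeriv i (components g.val φ j m) y
        + partialDeriv j (components g.val φ i m) y
        - partialDeriv m (components g.val φ i j) y) := by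
  set D : Fin n → ℝ := fun l ↦ partialDeriv i (components g.val φ j l) y
        + partialDeriv j (components g.val φ i l) y
        - partialDeriv l (components g.val φ i j) y
  have h1 : ∀ k, components g.val φ m k y * g.christoffel φ k i j y =
      ∑ l, (1 / 2) * (components g.val φ m k y * g.inverseComponents φ k l y * D l) := by
    intro k
    rw [christoffel, Finset.mul_sum, Finset.mul_sum]
    exact Finset.sum_congr rfl fun l _ ↦ by simp only [D]; ring
  simp_rw [h1]
  rw [Finset.sum_comm]
  have h2 : ∀ l, ∑ k, (1 / 2) * (components g.val φ m k y * g.inverseComponents φ k l y * D l) =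
      (if m = l then (1 / 2) * D l else 0) := by
    intro l
    rw [← Finset.mul_sum, ← Finset.sum_mul, h.sum_components_mul_inverse hy]
    split_ifs <;> ring
  simp_rw [h2]
  simp [D]

/-- The metric is covariantly constant. -/
theorem partialDeriv_components {y : EuclideanSpace ℝ (Fin n)} (hy : y ∈ φ.target)
    (k i j : Fin n) :
    partialDeriv k (components g.val φ i j) y =
      ∑ m, components g.val φ i m y * g.christoffel φ m k j y +
      ∑ m, components g.val φ j m y * g.christoffel φ m k i y := by
  rw [h.sum_components_mul_christoffel hy, h.sum_components_mul_christoffel hy,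
    components_comm g φ j i]
  ring

/-- The curvature component `R_{aaij}` vanishes. -/
theorem sum_components_mul_curvature {y : EuclideanSpace ℝ (Fin n)} (hy : y ∈ φ.target)
    (a i j : Fin n) :
    ∑ m, components g.val φ a m y * (partialDeriv i (g.christoffel φ m a j) y
      - partialDeriv j (g.christoffel φ m a i) y
      + ∑ l, (g.christoffel φ m i l y * g.christoffel φ l a j y
        - g.christoffel φ m j l y * g.christoffel φ l a i y)) = 0 := by
  -- Product rule applied to `g_{am} Γ^m_{aj} = ½ ∂_j g_{aa}`; the resulting second derivatives of
  -- `g_{aa}` cancel on antisymmetrizing in `i`, `j`.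
  have hlow : ∀ i j : Fin n,
      ∑ m, components g.val φ a m y * partialDeriv i (g.christoffel φ m a j) y =
      (1 / 2) * partialDeriv i (partialDeriv j (components g.val φ a a)) y -
      ∑ m, partialDeriv i (components g.val φ a m) y * g.christoffel φ m a j y := by
    intro i j
    have h1 : partialDeriv i (fun x ↦ ∑ m, components g.val φ a m x * g.christoffel φ m a j x) y
        = (1 / 2) * partialDeriv i (partialDeriv j (components g.val φ a a)) y := by
      rw [← partialDeriv_const_mul i _ (differentiableAt_of_mem_target (h.smooth_partialDeriv _ _ _) hy)]
      refine partialDeriv_congr_of_eqOn i φ.open_target (fun x hx ↦ ?_) hy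
      rw [h.sum_components_mul_christoffel hx, components_comm g φ j a]
      ring
    rw [partialDeriv_sum] at h1
    · rw [← h1, ← Finset.sum_sub_distrib]
      refine Finset.sum_congr rfl fun m _ ↦ ?_
      rw [partialDeriv_mul i (differentiableAt_of_mem_target (h.smooth _ _) hy)
        (differentiableAt_of_mem_target (h.smooth_christoffel _ _ _) hy)]
      ring
    · exact fun m _ ↦ (differentiableAt_of_mem_target (h.smooth _ _) hy).mul
        (differentiableAt_of_mem_target (h.smooth_christoffel _ _ _) hy)
  -- Metric compatibility expands `∂_i g_{am}`: one part cancels the quadratic terms of the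
  -- curvature, the other is symmetric in `i` and `j` (`hsymm`).
  have hquad : ∀ i j : Fin n,
      ∑ m, partialDeriv i (components g.val φ a m) y * g.christoffel φ m a j y =
      ∑ m, ∑ l, components g.val φ a m y * (g.christoffel φ m i l y * g.christoffel φ l a j y) +
      ∑ m, ∑ l, components g.val φ m l y * g.christoffel φ l a i y * g.christoffel φ m a j y := by
    intro i j
    simp_rw [h.partialDeriv_components hy, add_mul, Finset.sum_add_distrib, Finset.sum_mul]
    congr 1
    · rw [Finset.sum_comm]
      exact Finset.sum_congr rfl fun m _ ↦ Finset.sum_congr rfl fun l _ ↦ by ring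
    · exact Finset.sum_congr rfl fun m _ ↦ Finset.sum_congr rfl fun l _ ↦ by
        rw [christoffel_comm g φ l i a]
  have hsymm :
      ∑ m, ∑ l, components g.val φ m l y * g.christoffel φ l a i y * g.christoffel φ m a j y =
      ∑ m, ∑ l, components g.val φ m l y * g.christoffel φ l a j y * g.christoffel φ m a i y := by
    rw [Finset.sum_comm]
    exact Finset.sum_congr rfl fun m _ ↦ Finset.sum_congr rfl fun l _ ↦ by
      rw [components_comm g φ l m]; ring
  have e : ∀ m, components g.val φ a m y * (partialDeriv i (g.christoffel φ m a j) y
      - partialDeriv j (g.christoffel φ m a i) y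
      + ∑ l, (g.christoffel φ m i l y * g.christoffel φ l a j y
        - g.christoffel φ m j l y * g.christoffel φ l a i y)) =
      components g.val φ a m y * partialDeriv i (g.christoffel φ m a j) y
      - components g.val φ a m y * partialDeriv j (g.christoffel φ m a i) y
      + (∑ l, components g.val φ a m y * (g.christoffel φ m i l y * g.christoffel φ l a j y)
        - ∑ l, components g.val φ a m y * (g.christoffel φ m j l y * g.christoffel φ l a i y)) := by
    intro m
    rw [mul_add, mul_sub, Finset.mul_sum, ← Finset.sum_sub_distrib]
    simp_rw [mul_sub]
  simp_rw [e, Finset.sum_add_distrib, Finset.sum_sub_distrib]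
  rw [hlow, hlow, hquad, hquad, hsymm, partialDeriv_comm φ.open_target (h.smooth a a) hy i j]
  ring

end RegularIn

/-! ### Christoffel symbols and Ricci tensor on the horizon -/

namespace AdaptedIn

variable {a r : Fin n} (h : g.AdaptedIn φ a r)
include h

/-- All other entries of row `a` of the metric vanish on the horizon, so a zero here would make the
metric degenerate. -/
theorem components_ne_zero {y : EuclideanSpace ℝ (Fin n)} (hy : y ∈ φ.target) (hyr : y r = 0) :
    components g.val φ a r y ≠ 0 := by
  intro h0
  refine h.det_ne_zero y hy (Matrix.det_eq_zero_of_row_eq_zero a fun j ↦ ?_)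
  by_cases hj : j = r
  · subst hj; exact h0
  · exact h.normal y hy hyr j hj

/-- Row `a` of the metric has the single entry `g_{ar}`, so multiplying it with the inverse metric
leaves one term. Thus column `r` of the inverse is concentrated in row `a`. -/
theorem inverseComponents_eq {y : EuclideanSpace ℝ (Fin n)} (hy : y ∈ φ.target)
    (hyr : y r = 0) (k : Fin n) :
    components g.val φ a r y * g.inverseComponents φ k r y = if a = k then 1 else 0 := by
  rw [← h.sum_components_mul_inverse hy a k, Finset.sum_eq_single r,
    inverseComponents_comm g φ k r]
  · intro m _ hm
    rw [h.normal y hy hyr m hm, zero_mul]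
  · simp

theorem partialDeriv_normal {y : EuclideanSpace ℝ (Fin n)} (hy : y ∈ φ.target) (hyr : y r = 0)
    {i j : Fin n} (hi : i ≠ r) (hj : j ≠ r) : partialDeriv j (components g.val φ a i) y = 0 := by
  rw [partialDeriv_congr_of_eqOn_hyperplane (H := fun _ ↦ 0) hj φ.open_target
    (fun x hx hxr ↦ h.normal x hx hxr i hi) hy hyr
    (differentiableAt_of_mem_target (h.smooth _ _) hy) (differentiableAt_const _), partialDeriv_const]

/-- On the horizon, the covariant derivative of `∂/∂x^a` in tangential directions is proportional
to `∂/∂x^a`. -/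
theorem christoffel_eq {y : EuclideanSpace ℝ (Fin n)} (hy : y ∈ φ.target) (hyr : y r = 0)
    {j : Fin n} (hj : j ≠ r) (k : Fin n) :
    g.christoffel φ k a j y = if a = k then (1 / 2) * (partialDeriv j (components g.val φ a r) y
      - partialDeriv r (components g.val φ a j) y) / components g.val φ a r y else 0 := by
  have h1 : g.christoffel φ k a j y = (1 / 2) * (g.inverseComponents φ k r y *
      (partialDeriv j (components g.val φ a r) y - partialDeriv r (components g.val φ a j) y)) := by
    rw [christoffel, Finset.sum_eq_single r]
    · rw [h.partialDeriv_eq_zero y hy]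
      ring
    · intro l _ hl
      rw [h.partialDeriv_eq_zero y hy, h.partialDeriv_normal hy hyr hl hj,
        h.partialDeriv_normal hy hyr hj hl]
      ring
    · simp
  have h2 := h.inverseComponents_eq hy hyr k
  have h3 := h.components_ne_zero hy hyr
  rw [h1]
  split_ifs at h2 ⊢
  · rw [eq_div_iff h3]
    linear_combination (1 / 2) * (partialDeriv j (components g.val φ a r) y
      - partialDeriv r (components g.val φ a j) y) * h2
  · rw [(mul_eq_zero.1 h2).resolve_left h3]
    ring

theorem partialDeriv_christoffel_eq_zero {y : EuclideanSpace ℝ (Fin n)} (hy : y ∈ φ.target)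
    (hyr : y r = 0) {i j k : Fin n} (hi : i ≠ r) (hj : j ≠ r) (hk : a ≠ k) :
    partialDeriv i (g.christoffel φ k a j) y = 0 := by
  rw [partialDeriv_congr_of_eqOn_hyperplane (H := fun _ ↦ 0) hi φ.open_target
    (fun x hx hxr ↦ by rw [h.christoffel_eq hx hxr hj k, if_neg hk]) hy hyr
    (differentiableAt_of_mem_target (h.smooth_christoffel _ _ _) hy) (differentiableAt_const _),
    partialDeriv_const]

/-- Differentiating `g g⁻¹ = 1` along `x^a` leaves `g ∂_a g⁻¹ = 0`, and `g` is invertible. -/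
theorem partialDeriv_inverseComponents {y : EuclideanSpace ℝ (Fin n)} (hy : y ∈ φ.target)
    (i j : Fin n) : partialDeriv a (g.inverseComponents φ i j) y = 0 := by
  have h1 : ∀ k, ∑ m, components g.val φ k m y * partialDeriv a (g.inverseComponents φ m j) y
      = 0 := by
    intro k
    have h2 : partialDeriv a
        (fun x ↦ ∑ m, components g.val φ k m x * g.inverseComponents φ m j x) y = 0 := by
      rw [partialDeriv_congr_of_eqOn a φ.open_target
        (fun x hx ↦ h.sum_components_mul_inverse hx k j) hy, partialDeriv_const]
    rw [partialDeriv_sum] at h2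
    · rw [← h2]
      refine Finset.sum_congr rfl fun m _ ↦ ?_
      rw [partialDeriv_mul a (differentiableAt_of_mem_target (h.smooth _ _) hy)
        (differentiableAt_of_mem_target (h.smooth_inverseComponents _ _) hy),
        h.partialDeriv_eq_zero y hy]
      ring
    · exact fun m _ ↦ (differentiableAt_of_mem_target (h.smooth _ _) hy).mul
        (differentiableAt_of_mem_target (h.smooth_inverseComponents _ _) hy)
  have h3 := Matrix.eq_zero_of_mulVec_eq_zero (h.det_ne_zero y hy)
    (v := fun m ↦ partialDeriv a (g.inverseComponents φ m j) y) (funext h1)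
  exact congrFun h3 i

theorem partialDeriv_christoffel {y : EuclideanSpace ℝ (Fin n)} (hy : y ∈ φ.target)
    (k i j : Fin n) : partialDeriv a (g.christoffel φ k i j) y = 0 := by
  have hD : ∀ i j l, partialDeriv a (partialDeriv i (components g.val φ j l)) y = 0 := by
    intro i j l
    rw [partialDeriv_comm φ.open_target (h.smooth j l) hy, partialDeriv_congr_of_eqOn i
      φ.open_target (fun x hx ↦ h.partialDeriv_eq_zero x hx j l) hy, partialDeriv_const]
  have hdiff : ∀ i j l, DifferentiableAt ℝ (partialDeriv i (components g.val φ j l)) y :=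
    fun i j l ↦ differentiableAt_of_mem_target (h.smooth_partialDeriv _ _ _) hy
  have hinv : ∀ l, DifferentiableAt ℝ (g.inverseComponents φ k l) y :=
    fun l ↦ differentiableAt_of_mem_target (h.smooth_inverseComponents _ _) hy
  have hterm : ∀ l, DifferentiableAt ℝ (fun x ↦ partialDeriv i (components g.val φ j l) x
      + partialDeriv j (components g.val φ i l) x
      - partialDeriv l (components g.val φ i j) x) y :=
    fun l ↦ ((hdiff _ _ _).add (hdiff _ _ _)).sub (hdiff _ _ _)
  change partialDeriv a (fun x ↦ (1 / 2) * ∑ l, g.inverseComponents φ k l x *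
    (partialDeriv i (components g.val φ j l) x + partialDeriv j (components g.val φ i l) x
      - partialDeriv l (components g.val φ i j) x)) y = 0
  rw [partialDeriv_const_mul, partialDeriv_sum, Finset.sum_eq_zero, mul_zero]
  · intro l _
    rw [partialDeriv_mul a (hinv l) (hterm l), h.partialDeriv_inverseComponents hy, zero_mul,
      add_zero]
    have : partialDeriv a (fun x ↦ partialDeriv i (components g.val φ j l) x
      + partialDeriv j (components g.val φ i l) x
      - partialDeriv l (components g.val φ i j) x) y = 0 := by
      rw [partialDeriv, fderiv_fun_sub ((hdiff _ _ _).fun_add (hdiff _ _ _)) (hdiff _ _ _),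
        fderiv_fun_add (hdiff _ _ _) (hdiff _ _ _)]
      have h1 := hD i j l
      have h2 := hD j i l
      have h3 := hD l i j
      simp only [partialDeriv] at h1 h2 h3
      simp [h1, h2, h3]
    rw [this, mul_zero]
  · exact fun l _ ↦ (hinv l).mul (hterm l)
  · exact DifferentiableAt.fun_sum fun l _ ↦ (hinv l).mul (hterm l)

/-- On the horizon, the mixed Ricci components are the tangential derivatives of the surface
gravity, which is `Γ^a_{aa}` in adapted coordinates. -/
theorem ricci_eq {y : EuclideanSpace ℝ (Fin n)} (hy : y ∈ φ.target) (hyr : y r = 0)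
    {j : Fin n} (hj : j ≠ r) :
    g.ricci φ a j y = -partialDeriv j (g.christoffel φ a a a) y := by
  have hsplit : g.ricci φ a j y = ∑ k, (partialDeriv k (g.christoffel φ k a j) y
      - partialDeriv j (g.christoffel φ k a k) y
      + ∑ l, (g.christoffel φ k k l y * g.christoffel φ l a j y
        - g.christoffel φ k j l y * g.christoffel φ l a k y)) := by
    rw [ricci, Finset.sum_add_distrib]
  -- For tangential `m` only `Γ^a_{am}` survives among the `Γ^l_{am}`. The Ricci sum is then treated
  -- one `k` at a time, and only `k = a` contributes.
  have hl : ∀ (i k m : Fin n), m ≠ r → ∑ l, g.christoffel φ i k l y * g.christoffel φ l a m y =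
      g.christoffel φ i k a y * g.christoffel φ a a m y := by
    intro i k m hm
    refine Finset.sum_eq_single a (fun l _ hla ↦ ?_) (by simp)
    rw [h.christoffel_eq hy hyr hm l, if_neg hla.symm, mul_zero]
  rw [hsplit, Finset.sum_eq_single a]
  · rw [Finset.sum_sub_distrib, hl _ _ _ hj, hl _ _ _ h.ne, h.partialDeriv_christoffel hy,
      christoffel_comm g φ a j a]
    ring
  · intro k _ hka
    by_cases hkr : k = r
    -- For `k = r` the summand involves transversal derivatives, which adaptedness does not control.
    -- It is the curvature component with upper index `r`, and lowering that index with `g_{am}`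
    -- yields `g_{ar}` times it, which is `R_{aarj} = 0`.
    · subst hkr
      have h0 := h.sum_components_mul_curvature hy a k j
      rw [Finset.sum_eq_single k] at h0
      · exact (mul_eq_zero.1 h0).resolve_left (h.components_ne_zero hy hyr)
      · intro m _ hm
        rw [h.normal y hy hyr m hm, zero_mul]
      · simp
    · rw [Finset.sum_sub_distrib, hl _ _ _ hj, hl _ _ _ hkr,
        h.partialDeriv_christoffel_eq_zero hy hyr hkr hj hka.symm,
        h.partialDeriv_christoffel_eq_zero hy hyr hj hkr hka.symm,
        christoffel_comm g φ k k a, christoffel_comm g φ k j a,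
        h.christoffel_eq hy hyr hj k, h.christoffel_eq hy hyr hkr k, if_neg hka.symm,
        if_neg hka.symm]
      ring
  · simp

/-- The coordinate formula is not visibly symmetric because of the term `∂_j Γ^k_{ik}`. With one
index equal to `a` that term is zero both ways: `Γ^k_{ak} = ½ g^{kl} ∂_a g_{kl}` vanishes, and so
does `∂_a` of any Christoffel symbol. -/
theorem ricci_comm {y : EuclideanSpace ℝ (Fin n)} (hy : y ∈ φ.target) (j : Fin n) :
    g.ricci φ j a y = g.ricci φ a j y := by
  have htr : ∀ x ∈ φ.target, ∑ k, g.christoffel φ k a k x = 0 := by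
    intro x hx
    simp only [christoffel, h.partialDeriv_eq_zero x hx, ← Finset.mul_sum]
    have h1 : ∑ k, ∑ l, g.inverseComponents φ k l x * partialDeriv k (components g.val φ a l) x =
        ∑ k, ∑ l, g.inverseComponents φ k l x * partialDeriv l (components g.val φ a k) x := by
      rw [Finset.sum_comm]
      exact Finset.sum_congr rfl fun k _ ↦ Finset.sum_congr rfl fun l _ ↦ by
        rw [inverseComponents_comm]
    simp only [zero_add, mul_sub, Finset.sum_sub_distrib, h1, sub_self, mul_zero]
  have htr' : ∑ k, partialDeriv j (g.christoffel φ k a k) y = 0 := by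
    rw [← partialDeriv_sum Finset.univ j
      fun k _ ↦ differentiableAt_of_mem_target (h.smooth_christoffel k a k) hy,
      partialDeriv_congr_of_eqOn j φ.open_target htr hy, partialDeriv_const]
  have hq : ∑ k, ∑ l, g.christoffel φ k a l y * g.christoffel φ l j k y =
      ∑ k, ∑ l, g.christoffel φ k j l y * g.christoffel φ l a k y := by
    rw [Finset.sum_comm]
    exact Finset.sum_congr rfl fun k _ ↦ Finset.sum_congr rfl fun l _ ↦ by ring
  simp only [ricci, Finset.sum_sub_distrib, h.partialDeriv_christoffel hy, htr', hq,
    Finset.sum_const_zero, christoffel_comm g φ _ j a]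

/-- The direction `x^a` is itself tangential, and `Γ^a_{aa}` is invariant along the flow. -/
theorem ricci_self {y : EuclideanSpace ℝ (Fin n)} (hy : y ∈ φ.target) (hyr : y r = 0) :
    g.ricci φ a a y = 0 := by
  rw [h.ricci_eq hy hyr h.ne, h.partialDeriv_christoffel hy, neg_zero]

end AdaptedIn
end LorentzMetric

/-! ### Charts straightening a hypersurface and a flow -/

section Charts

variable {n : ℕ} {M : Type*} [TopologicalSpace M]
    [ChartedSpace (EuclideanSpace ℝ (Fin n)) M]

/-- The inverse function theorem, with smoothness on the whole domain of the local inverse. -/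
theorem exists_openPartialHomeomorph_of_injective_fderiv {E : Type*} [NormedAddCommGroup E]
    [NormedSpace ℝ E] [FiniteDimensional ℝ E] {F : E → E} {W : Set E} {x₀ : E} (hW : IsOpen W)
    (hx₀ : x₀ ∈ W) (hF : ContDiffOn ℝ ∞ F W) (hinj : ∀ v, fderiv ℝ F x₀ v = 0 → v = 0) :
    ∃ e : OpenPartialHomeomorph E E, x₀ ∈ e.source ∧ e.source ⊆ W ∧ (∀ x, e x = F x) ∧
      ContDiffOn ℝ ∞ e e.source ∧ ContDiffOn ℝ ∞ e.symm e.target := by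
  have := FiniteDimensional.complete ℝ E
  have hequiv : ∃ A : E ≃L[ℝ] E, (A : E →L[ℝ] E) = fderiv ℝ F x₀ := by
    refine ⟨(LinearEquiv.ofInjectiveEndo (fderiv ℝ F x₀ : E →ₗ[ℝ] E) ?_).toContinuousLinearEquiv,
      ?_⟩
    · rw [← LinearMap.ker_eq_bot, LinearMap.ker_eq_bot']
      exact hinj
    · ext v
      rfl
  obtain ⟨A, hA⟩ := hequiv
  have hFx₀ : ContDiffAt ℝ ∞ F x₀ := hF.contDiffAt (hW.mem_nhds hx₀)
  have hd : HasFDerivAt F (A : E →L[ℝ] E) x₀ := by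
    rw [hA]
    exact (hFx₀.differentiableAt (by simp)).hasFDerivAt
  set e₀ := hFx₀.toOpenPartialHomeomorph F hd (by simp)
  have hcont : ContinuousOn (fderiv ℝ F) W := hF.continuousOn_fderiv_of_isOpen hW (by simp)
  -- Shrinking to the open set where the derivative is invertible makes the inverse smooth at every
  -- point of its domain, not only at the image of `x₀`.
  set W' := W ∩ fderiv ℝ F ⁻¹' range ((↑) : (E ≃L[ℝ] E) → E →L[ℝ] E)
  have hW'o : IsOpen W' := hcont.isOpen_inter_preimage hW (ContinuousLinearEquiv.isOpen)
  refine ⟨e₀.restrOpen W' hW'o, ⟨hFx₀.mem_toOpenPartialHomeomorph_source hd (by simp), hx₀, A, hA⟩,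
    fun x hx ↦ hx.2.1, fun x ↦ rfl, ?_, ?_⟩
  · exact hF.mono fun x hx ↦ hx.2.1
  · intro y hy
    have hmem := (e₀.restrOpen W' hW'o).map_target hy
    obtain ⟨B, hB⟩ := hmem.2.2
    refine ((e₀.restrOpen W' hW'o).contDiffAt_symm hy (f₀' := B) ?_ ?_).contDiffWithinAt
    · rw [hB]
      exact ((hF.contDiffAt (hW.mem_nhds hmem.2.1)).differentiableAt (by simp)).hasFDerivAt
    · exact hF.contDiffAt (hW.mem_nhds hmem.2.1)

theorem trans_mem_maximalAtlas [IsManifold (𝓡 n) ∞ M]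
    {φ : OpenPartialHomeomorph M (EuclideanSpace ℝ (Fin n))}
    (hφ : φ ∈ IsManifold.maximalAtlas (𝓡 n) ∞ M)
    {e : OpenPartialHomeomorph (EuclideanSpace ℝ (Fin n)) (EuclideanSpace ℝ (Fin n))}
    (he : ContDiffOn ℝ ∞ e e.source) (he' : ContDiffOn ℝ ∞ e.symm e.target) :
    φ ≫ₕ e ∈ IsManifold.maximalAtlas (𝓡 n) ∞ M := by
  apply OpenPartialHomeomorph.mem_maximalAtlas_of_contMDiffOn
  · exact he.contMDiffOn.comp ((contMDiffOn_of_mem_maximalAtlas hφ).mono fun x hx ↦ hx.1)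
      fun x hx ↦ hx.2
  · refine (contMDiffOn_symm_of_mem_maximalAtlas hφ).comp
      (he'.contMDiffOn.mono fun x hx ↦ hx.1) fun x hx ↦ hx.2

theorem chart_mdifferentiable [IsManifold (𝓡 n) ∞ M]
    {φ : OpenPartialHomeomorph M (EuclideanSpace ℝ (Fin n))}
    (hφ : φ ∈ IsManifold.maximalAtlas (𝓡 n) ∞ M) : φ.MDifferentiable (𝓡 n) (𝓡 n) :=
  ⟨(contMDiffOn_of_mem_maximalAtlas hφ).mdifferentiableOn (by simp),
    (contMDiffOn_symm_of_mem_maximalAtlas hφ).mdifferentiableOn (by simp)⟩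

theorem contDiffOn_comp_symm [IsManifold (𝓡 n) ∞ M]
    {φ : OpenPartialHomeomorph M (EuclideanSpace ℝ (Fin n))}
    (hφ : φ ∈ IsManifold.maximalAtlas (𝓡 n) ∞ M) {U : Set M} {f : M → ℝ}
    (hf : ContMDiffOn (𝓡 n) 𝓘(ℝ, ℝ) ∞ f U) :
    ContDiffOn ℝ ∞ (f ∘ φ.symm) (φ.target ∩ φ.symm ⁻¹' U) :=
  contMDiffOn_iff_contDiffOn.1 (hf.comp
    ((contMDiffOn_symm_of_mem_maximalAtlas hφ).mono inter_subset_left) fun _ hx ↦ hx.2)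

/-- In coordinates, the differential of a function is given by its partial derivatives. -/
theorem mvfderiv_coordVector [IsManifold (𝓡 n) ∞ M]
    {φ : OpenPartialHomeomorph M (EuclideanSpace ℝ (Fin n))}
    (hφ : φ ∈ IsManifold.maximalAtlas (𝓡 n) ∞ M) {f : M → ℝ} {y : EuclideanSpace ℝ (Fin n)}
    (hy : y ∈ φ.target) (hf : MDifferentiableAt (𝓡 n) 𝓘(ℝ, ℝ) f (φ.symm y)) (j : Fin n) :
    mvfderiv (𝓡 n) f (φ.symm y) (coordVector φ j y) = partialDeriv j (f ∘ φ.symm) y := by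
  have h1 := mfderiv_comp y hf ((chart_mdifferentiable hφ).mdifferentiableAt_symm hy)
  rw [mfderiv_eq_fderiv] at h1
  rw [partialDeriv, h1]
  rfl

theorem mfderiv_symm_eq_sum (φ : OpenPartialHomeomorph M (EuclideanSpace ℝ (Fin n)))
    (y v : EuclideanSpace ℝ (Fin n)) :
    mfderiv (𝓡 n) (𝓡 n) φ.symm y v = ∑ j, v j • coordVector φ j y := by
  have hv : v = ∑ j, v j • EuclideanSpace.single j (1 : ℝ) := by
    ext i
    simp [Pi.single_apply]
  conv_lhs => rw [hv]
  exact (map_sum (mfderiv (𝓡 n) (𝓡 n) φ.symm y) _ _).trans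
    (Finset.sum_congr rfl fun j _ ↦ map_smul (mfderiv (𝓡 n) (𝓡 n) φ.symm y) _ _)

theorem exists_sum_coordVector [IsManifold (𝓡 n) ∞ M]
    {φ : OpenPartialHomeomorph M (EuclideanSpace ℝ (Fin n))}
    (hφ : φ ∈ IsManifold.maximalAtlas (𝓡 n) ∞ M) {y : EuclideanSpace ℝ (Fin n)}
    (hy : y ∈ φ.target) (w : TangentSpace (𝓡 n) (φ.symm y)) :
    ∃ c : Fin n → ℝ, w = ∑ j, c j • coordVector φ j y := by
  obtain ⟨v, hv⟩ := (chart_mdifferentiable hφ).symm.mfderiv_surjective hy w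
  exact ⟨fun j ↦ WithLp.ofLp v j, hv.symm.trans (mfderiv_symm_eq_sum φ y v)⟩

theorem eq_zero_of_sum_coordVector_eq_zero [IsManifold (𝓡 n) ∞ M]
    {φ : OpenPartialHomeomorph M (EuclideanSpace ℝ (Fin n))}
    (hφ : φ ∈ IsManifold.maximalAtlas (𝓡 n) ∞ M) {y : EuclideanSpace ℝ (Fin n)}
    (hy : y ∈ φ.target) {c : Fin n → ℝ} (hc : ∑ j, c j • coordVector φ j y = 0) : c = 0 := by
  have h1 : mfderiv (𝓡 n) (𝓡 n) φ.symm y (WithLp.toLp 2 c) = 0 :=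
    (mfderiv_symm_eq_sum φ y (WithLp.toLp 2 c)).trans hc
  have h2 : (WithLp.toLp 2 c : EuclideanSpace ℝ (Fin n)) = 0 :=
    (chart_mdifferentiable hφ).symm.mfderiv_injective hy (h1.trans (map_zero _).symm)
  funext j
  exact congrArg (fun v : EuclideanSpace ℝ (Fin n) ↦ v j) h2

theorem contMDiffOn_coordVector [IsManifold (𝓡 n) ∞ M]
    {φ : OpenPartialHomeomorph M (EuclideanSpace ℝ (Fin n))}
    (hφ : φ ∈ IsManifold.maximalAtlas (𝓡 n) ∞ M) (i : Fin n) :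
    ContMDiffOn (𝓡 n) (𝓡 n).tangent ∞
      (fun y ↦ (⟨φ.symm y, coordVector φ i y⟩ : TangentBundle (𝓡 n) M)) φ.target := by
  have h1 := (contMDiffOn_symm_of_mem_maximalAtlas hφ).contMDiffOn_tangentMapWithin (m := ∞)
    (by simp) φ.open_target.uniqueMDiffOn
  have h2 : ContMDiff (𝓡 n) (𝓡 n).tangent ∞ (fun y : EuclideanSpace ℝ (Fin n) ↦
      (⟨y, EuclideanSpace.single i (1 : ℝ)⟩ :
        TangentBundle (𝓡 n) (EuclideanSpace ℝ (Fin n)))) := by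
    exact contMDiff_vectorSpace_iff_contDiff
      (V := fun _ ↦ (EuclideanSpace.single i (1 : ℝ) : EuclideanSpace ℝ (Fin n))).2 contDiff_const
  refine (h1.comp h2.contMDiffOn fun y hy ↦ hy).congr fun y hy ↦ ?_
  simp only [Function.comp, tangentMapWithin, coordVector,
    mfderivWithin_of_mem_nhds (φ.open_target.mem_nhds hy)]

namespace LorentzMetric

variable [IsManifold (𝓡 n) ∞ M]

theorem contDiffOn_components (g : LorentzMetric n M)
    {φ : OpenPartialHomeomorph M (EuclideanSpace ℝ (Fin n))}
    (hφ : φ ∈ IsManifold.maximalAtlas (𝓡 n) ∞ M) (i j : Fin n) :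
    ContDiffOn ℝ ∞ (components g.val φ i j) φ.target := by
  rw [← contMDiffOn_iff_contDiffOn]
  have hg := g.smooth.comp_contMDiffOn (contMDiffOn_symm_of_mem_maximalAtlas hφ)
  intro y hy
  have := ContMDiffWithinAt.clm_bundle_apply₂ (F₁ := EuclideanSpace ℝ (Fin n))
    (F₂ := EuclideanSpace ℝ (Fin n)) (F₃ := ℝ)
    (E₁ := fun p : M ↦ TangentSpace (𝓡 n) p) (E₂ := fun p : M ↦ TangentSpace (𝓡 n) p)
    (E₃ := fun _ ↦ ℝ) (hg y hy) (contMDiffOn_coordVector hφ i y hy)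
    (contMDiffOn_coordVector hφ j y hy)
  rw [Bundle.contMDiffWithinAt_totalSpace] at this
  exact this.2

theorem regularIn (g : LorentzMetric n M)
    {φ : OpenPartialHomeomorph M (EuclideanSpace ℝ (Fin n))}
    (hφ : φ ∈ IsManifold.maximalAtlas (𝓡 n) ∞ M) : g.RegularIn φ where
  smooth := g.contDiffOn_components hφ
  det_ne_zero y hy h0 := by
    -- A kernel vector of the Gram matrix is the coordinate vector of a tangent vector orthogonal to
    -- everything.
    obtain ⟨c, hc0, hc⟩ := Matrix.exists_mulVec_eq_zero_iff.2 h0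
    refine hc0 (eq_zero_of_sum_coordVector_eq_zero hφ hy (g.eq_zero_of_forall _ _ fun w ↦ ?_))
    obtain ⟨d, rfl⟩ := exists_sum_coordVector hφ hy w
    rw [map_sum]
    refine Finset.sum_eq_zero fun i _ ↦ ?_
    have hi := congrFun hc i
    simp only [Matrix.mulVec, dotProduct, Matrix.of_apply, Pi.zero_apply, components] at hi
    rw [map_smul, g.symm, map_sum]
    simp only [map_smul, smul_eq_mul]
    rw [← mul_zero (d i), ← hi]
    congr 1
    exact Finset.sum_congr rfl fun j _ ↦ mul_comm _ _

end LorentzMetric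

/-- A function with nonvanishing differential is locally one of the coordinates of a chart. -/
theorem exists_chart_coordinate_eq [IsManifold (𝓡 n) ∞ M] {U : Set M} {f : M → ℝ} {p : M}
    (hU : IsOpen U) (hp : p ∈ U) (hf : ContMDiffOn (𝓡 n) 𝓘(ℝ, ℝ) ∞ f U)
    (hdf : mvfderiv (𝓡 n) f p ≠ 0) :
    ∃ φ ∈ IsManifold.maximalAtlas (𝓡 n) ∞ M, ∃ r : Fin n, p ∈ φ.source ∧ φ.source ⊆ U ∧
      ∀ q ∈ φ.source, φ q r = f q := by
  set φ := chartAt (EuclideanSpace ℝ (Fin n)) p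
  have hφ : φ ∈ IsManifold.maximalAtlas (𝓡 n) ∞ M := IsManifold.chart_mem_maximalAtlas p
  have hps : p ∈ φ.source := mem_chart_source _ p
  have hy : φ p ∈ φ.target := φ.map_source hps
  have hsymm : φ.symm (φ p) = p := φ.left_inv hps
  set W := φ.target ∩ φ.symm ⁻¹' U
  have hW : IsOpen W := φ.isOpen_inter_preimage_symm hU
  have hyW : φ p ∈ W := ⟨hy, by rw [mem_preimage, hsymm]; exact hp⟩
  have hF : ContDiffOn ℝ ∞ (f ∘ φ.symm) W := contDiffOn_comp_symm hφ hf
  have hr : ∃ r, partialDeriv r (f ∘ φ.symm) (φ p) ≠ 0 := by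
    by_contra! hcon
    apply hdf
    have hmd : MDifferentiableAt (𝓡 n) 𝓘(ℝ, ℝ) f (φ.symm (φ p)) := by
      rw [hsymm]
      exact (hf.contMDiffAt (hU.mem_nhds hp)).mdifferentiableAt (by simp)
    have h0 : mvfderiv (𝓡 n) f (φ.symm (φ p)) = 0 := by
      ext w
      obtain ⟨c, rfl⟩ := exists_sum_coordVector hφ hy w
      rw [map_sum]
      refine Finset.sum_eq_zero fun j _ ↦ ?_
      rw [map_smul, mvfderiv_coordVector hφ hy hmd, hcon, smul_zero]
    rw [hsymm] at h0
    exact h0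
  obtain ⟨r, hr⟩ := hr
  set er : EuclideanSpace ℝ (Fin n) := EuclideanSpace.single r (1 : ℝ) with her
  -- `Θ` replaces the `r`-th coordinate by `f`. A kernel vector of its derivative is a multiple of
  -- `e_r`, and along `e_r` the derivative is `∂_r f ≠ 0`.
  set Θ : EuclideanSpace ℝ (Fin n) → EuclideanSpace ℝ (Fin n) :=
    fun y ↦ y + ((f ∘ φ.symm) y - EuclideanSpace.proj (𝕜 := ℝ) r y) • er with hΘ
  have hΘs : ContDiffOn ℝ ∞ Θ W :=
    contDiffOn_id.add ((hF.sub (EuclideanSpace.proj (𝕜 := ℝ) r).contDiff.contDiffOn).smul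
      contDiffOn_const)
  have hFd : DifferentiableAt ℝ (f ∘ φ.symm) (φ p) :=
    (hF.contDiffAt (hW.mem_nhds hyW)).differentiableAt (by simp)
  have hΘd : HasFDerivAt Θ (ContinuousLinearMap.id ℝ _ +
      (fderiv ℝ (f ∘ φ.symm) (φ p) - EuclideanSpace.proj (𝕜 := ℝ) r).smulRight er) (φ p) :=
    (hasFDerivAt_id _).add
      ((hFd.hasFDerivAt.sub (EuclideanSpace.proj (𝕜 := ℝ) r).hasFDerivAt).smul_const er)
  obtain ⟨e, hpe, heW, heF, hes, hes'⟩ :=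
    exists_openPartialHomeomorph_of_injective_fderiv hW hyW hΘs (by
      intro v hv
      rw [hΘd.fderiv] at hv
      have hv' : v = (-(fderiv ℝ (f ∘ φ.symm) (φ p) v - v r)) • er := by
        rw [neg_smul]
        exact eq_neg_of_add_eq_zero_left hv
      have hvr : fderiv ℝ (f ∘ φ.symm) (φ p) v = 0 := by
        have := congrArg (fun w : EuclideanSpace ℝ (Fin n) ↦ w r) hv'
        simp [her] at this
        linarith
      rw [hvr, zero_sub, neg_neg] at hv'
      rw [hv', map_smul, smul_eq_mul] at hvr
      rw [hv', (mul_eq_zero.1 hvr).resolve_right hr, zero_smul])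
  refine ⟨φ ≫ₕ e, trans_mem_maximalAtlas hφ hes hes', r, ⟨hps, hpe⟩, fun q hq ↦ ?_, fun q hq ↦ ?_⟩
  · have h1 := (heW hq.2).2
    rwa [mem_preimage, φ.symm_symm, φ.left_inv hq.1] at h1
  · rw [OpenPartialHomeomorph.coe_trans, Function.comp_apply, heF]
    simp [hΘ, her, φ.left_inv hq.1]

end Charts

section Flow

variable {n : ℕ} {M : Type*} [TopologicalSpace M]
    [ChartedSpace (EuclideanSpace ℝ (Fin n)) M] [IsManifold (𝓡 n) ∞ M]

/-- A flow that moves `p` in the direction of the coordinate `x^a` is locally the translation along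
`x^a` of another chart, which arises from the first one by moving the slice `x^a = const`. -/
theorem exists_chart_flow {χ : ℝ → M → M}
    (hχ : ContMDiff (𝓘(ℝ, ℝ).prod (𝓡 n)) (𝓡 n) ∞ (fun q : ℝ × M ↦ χ q.1 q.2))
    (hχ0 : ∀ p, χ 0 p = p)
    {ψ : OpenPartialHomeomorph M (EuclideanSpace ℝ (Fin n))}
    (hψ : ψ ∈ IsManifold.maximalAtlas (𝓡 n) ∞ M) {p : M} (hp : p ∈ ψ.source)
    {k : EuclideanSpace ℝ (Fin n)} (hk : HasDerivAt (fun u ↦ ψ (χ u p)) k 0) {a : Fin n}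
    (ha : k a ≠ 0) :
    ∃ φ ∈ IsManifold.maximalAtlas (𝓡 n) ∞ M, p ∈ φ.source ∧ ∀ y ∈ φ.target,
      ψ p + (y - y a • EuclideanSpace.single a (1 : ℝ)) ∈ ψ.target ∧
      φ.symm y = χ (y a) (ψ.symm (ψ p + (y - y a • EuclideanSpace.single a (1 : ℝ)))) := by
  set ea : EuclideanSpace ℝ (Fin n) := EuclideanSpace.single a (1 : ℝ) with hea
  -- `P` places `y`, stripped of its `a`-th coordinate, in the slice through `ψ p`; `Q` then flows
  -- for the time `y a`. At the origin the derivative of `ψ ∘ Q` fixes the slice directions and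
  -- sends `e_a` to the velocity `k`, so it is injective because `k a ≠ 0`.
  set P : EuclideanSpace ℝ (Fin n) → EuclideanSpace ℝ (Fin n) :=
    fun y ↦ ψ p + (y - EuclideanSpace.proj (𝕜 := ℝ) a y • ea) with hP
  have hPs : ContDiff ℝ ∞ P := by
    have := (EuclideanSpace.proj a : EuclideanSpace ℝ (Fin n) →L[ℝ] ℝ).contDiff (n := ∞)
    exact contDiff_const.add (contDiff_id.sub (this.smul contDiff_const))
  set V : Set (EuclideanSpace ℝ (Fin n)) := P ⁻¹' ψ.target with hV
  have hVo : IsOpen V := ψ.open_target.preimage hPs.continuous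
  set Q : EuclideanSpace ℝ (Fin n) → M :=
    fun y ↦ χ (EuclideanSpace.proj (𝕜 := ℝ) a y) (ψ.symm (P y)) with hQ
  have hQs : ContMDiffOn (𝓡 n) (𝓡 n) ∞ Q V := by
    have h1 : ContMDiffOn (𝓡 n) (𝓡 n) ∞ (fun y ↦ ψ.symm (P y)) V :=
      (contMDiffOn_symm_of_mem_maximalAtlas hψ).comp hPs.contMDiff.contMDiffOn fun y hy ↦ hy
    have h2 : ContMDiffOn (𝓡 n) 𝓘(ℝ, ℝ) ∞
        (fun y : EuclideanSpace ℝ (Fin n) ↦ EuclideanSpace.proj (𝕜 := ℝ) a y) V :=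
      (EuclideanSpace.proj a : EuclideanSpace ℝ (Fin n) →L[ℝ] ℝ).contDiff.contMDiff.contMDiffOn
    exact hχ.comp_contMDiffOn (h2.prodMk h1)
  set W := V ∩ Q ⁻¹' ψ.source with hW
  have hWo : IsOpen W := hQs.continuousOn.isOpen_inter_preimage hVo ψ.open_source
  have hΦs : ContDiffOn ℝ ∞ (fun y ↦ ψ (Q y)) W := by
    rw [← contMDiffOn_iff_contDiffOn]
    exact (contMDiffOn_of_mem_maximalAtlas hψ).comp (hQs.mono inter_subset_left) fun y hy ↦ hy.2
  have hP0 : P 0 = ψ p := by simp [hP]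
  have hQ0 : Q 0 = p := by simp [hQ, hP0, hχ0, ψ.left_inv hp]
  have h0W : (0 : EuclideanSpace ℝ (Fin n)) ∈ W := by
    refine ⟨?_, ?_⟩
    · rw [hV, mem_preimage, hP0]; exact ψ.map_source hp
    · rw [mem_preimage, hQ0]; exact hp
  have hd : DifferentiableAt ℝ (fun y ↦ ψ (Q y)) 0 :=
    (hΦs.contDiffAt (hWo.mem_nhds h0W)).differentiableAt (by simp)
  have hline : ∀ v, HasDerivAt (fun t : ℝ ↦ ψ (Q (t • v)))
      (fderiv ℝ (fun y ↦ ψ (Q y)) 0 v) 0 := by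
    intro v
    have h1 : HasDerivAt (fun t : ℝ ↦ t • v) v 0 := by
      simpa using (hasDerivAt_id (0 : ℝ)).smul_const v
    have h2 : HasFDerivAt (fun y ↦ ψ (Q y)) (fderiv ℝ (fun y ↦ ψ (Q y)) 0) ((0 : ℝ) • v) := by
      simpa using hd.hasFDerivAt
    exact h2.comp_hasDerivAt _ h1
  have hda : fderiv ℝ (fun y ↦ ψ (Q y)) 0 ea = k := by
    refine (hline ea).unique (hk.congr_of_eventuallyEq (Filter.Eventually.of_forall fun t ↦ ?_))
    simp [hQ, hP, hea, ψ.left_inv hp]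
  have hdw : ∀ w : EuclideanSpace ℝ (Fin n), w a = 0 →
      fderiv ℝ (fun y ↦ ψ (Q y)) 0 w = w := by
    intro w hw
    have h1 : HasDerivAt (fun t : ℝ ↦ ψ p + t • w) w 0 := by
      simpa using ((hasDerivAt_id (0 : ℝ)).smul_const w).const_add (ψ p)
    refine (hline w).unique (h1.congr_of_eventuallyEq ?_)
    have hc : Continuous fun t : ℝ ↦ t • w := by fun_prop
    filter_upwards [hc.continuousAt.eventually_mem (hVo.mem_nhds (by simpa using h0W.1))] with t ht
    have hPt : P (t • w) = ψ p + t • w := by simp [hP, hw]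
    simp only [hQ, hPt]
    rw [hV, mem_preimage, hPt] at ht
    simp [hw, hχ0, ψ.right_inv ht]
  obtain ⟨e, h0e, heW, heF, hes, hes'⟩ :=
    exists_openPartialHomeomorph_of_injective_fderiv hWo h0W hΦs (by
      intro v hv
      have hva : (v - v a • ea) a = 0 := by simp [hea]
      have hdec : v = v a • ea + (v - v a • ea) := by abel
      rw [hdec, map_add, map_smul, hda, hdw _ hva] at hv
      have h1 := congrArg (fun w : EuclideanSpace ℝ (Fin n) ↦ w a) hv
      simp only [PiLp.add_apply, hva, PiLp.smul_apply, smul_eq_mul, add_zero,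
        PiLp.zero_apply] at h1
      have h2 : v a = 0 := (mul_eq_zero.1 h1).resolve_right ha
      simpa [h2] using hv)
  refine ⟨ψ ≫ₕ e.symm, trans_mem_maximalAtlas hψ hes' (by simpa using hes), ⟨hp, ?_⟩, ?_⟩
  · have h1 := e.map_source h0e
    rw [heF, hQ0] at h1
    exact h1
  · intro y hy
    have hye : y ∈ e.source := hy.1
    have h1 := heW hye
    refine ⟨h1.1, ?_⟩
    change ψ.symm (e y) = Q y
    rw [heF, ψ.left_inv h1.2]

end Flow

/-! ### The Killing flow near the horizon -/

namespace Spacetime.ClassA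

variable {n : ℕ} {M : Type*} [TopologicalSpace M]
    [ChartedSpace (EuclideanSpace ℝ (Fin n)) M] [IsManifold (𝓡 n) ∞ M] {S : Spacetime n M}
    {Z : Type*} [TopologicalSpace Z]
    [ChartedSpace (EuclideanSpace ℝ (Fin (n - 2))) Z] [IsManifold (𝓡 (n - 2)) ∞ Z]
    (A : S.ClassA Z)

theorem χ_mem_N_iff (u : ℝ) (p : M) : A.χ u p ∈ A.N ↔ p ∈ A.N := by
  refine ⟨fun h ↦ ?_, fun h ↦ A.N_invariant u h⟩
  have := A.N_invariant (-u) h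
  rwa [← A.χ_add, neg_add_cancel, A.χ_zero] at this

theorem continuous_orbit (p : M) : Continuous fun u ↦ A.χ u p :=
  A.χ_smooth.continuous.comp (by fun_prop : Continuous fun u : ℝ ↦ (u, p))

theorem hasMFDerivAt_orbit (p : M) :
    HasMFDerivAt 𝓘(ℝ, ℝ) (𝓡 n) (fun u ↦ A.χ u p) 0
      ((1 : ℝ →L[ℝ] ℝ).smulRight (A.K (A.χ 0 p))) :=
  A.K_generates p 0

/-- The velocity of the orbit of `p` in a chart. -/
theorem exists_hasDerivAt_chart_orbit {ψ : OpenPartialHomeomorph M (EuclideanSpace ℝ (Fin n))}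
    (hψ : ψ ∈ IsManifold.maximalAtlas (𝓡 n) ∞ M) {p : M} (hp : p ∈ ψ.source)
    (hK : A.K p ≠ 0) :
    ∃ k : EuclideanSpace ℝ (Fin n), k ≠ 0 ∧ HasDerivAt (fun u ↦ ψ (A.χ u p)) k 0 := by
  have h0 := A.hasMFDerivAt_orbit p
  have h1 : HasMFDerivAt (𝓡 n) (𝓡 n) ψ (A.χ 0 p) (mfderiv (𝓡 n) (𝓡 n) ψ (A.χ 0 p)) := by
    rw [A.χ_zero]
    exact ((chart_mdifferentiable hψ).mdifferentiableAt hp).hasMFDerivAt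
  have h2 : HasFDerivAt (fun u ↦ ψ (A.χ u p)) (_ : ℝ →L[ℝ] EuclideanSpace ℝ (Fin n)) 0 :=
    (h1.comp (0 : ℝ) h0).hasFDerivAt
  refine ⟨_, fun h3 ↦ ?_, h2.hasDerivAt⟩
  have h4 : A.K (A.χ 0 p) = 0 := by
    refine (chart_mdifferentiable hψ).mfderiv_injective (x := A.χ 0 p) (by rwa [A.χ_zero]) ?_
    rw [map_zero]
    have h5 : (1 : ℝ →L[ℝ] ℝ).smulRight (A.K (A.χ 0 p)) 1 = A.K (A.χ 0 p) :=
      one_smul ℝ (A.K (A.χ 0 p))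
    rw [← h5]
    exact h3
  rw [A.χ_zero] at h4
  exact hK h4

/-- Near each point of the horizon there are coordinates in which the horizon is `x^r = 0` and the
isometries are translations along `x^a`. -/
theorem exists_adapted_chart {p : M} (hp : p ∈ A.N) :
    ∃ φ ∈ IsManifold.maximalAtlas (𝓡 n) ∞ M, ∃ a r : Fin n, a ≠ r ∧ p ∈ φ.source ∧
      (∀ y ∈ φ.target, φ.symm y ∈ A.N ↔ y r = 0) ∧
      ∀ y ∈ φ.target, ∀ u : ℝ, y + u • EuclideanSpace.single a (1 : ℝ) ∈ φ.target →
        φ.symm (y + u • EuclideanSpace.single a (1 : ℝ)) = A.χ u (φ.symm y) := by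
  obtain ⟨U, f, hU, hpU, hf, hNU, hdf⟩ := A.N_null p hp
  obtain ⟨ψ, hψ, r, hpψ, hψU, hψr⟩ := exists_chart_coordinate_eq hU hpU hf (hdf p ⟨hp, hpU⟩).1
  have hN : ∀ q ∈ ψ.source, q ∈ A.N ↔ ψ q r = 0 := by
    intro q hq
    have h1 : q ∈ A.N ∩ U ↔ q ∈ {q ∈ U | f q = 0} := by rw [hNU]
    have h2 := hψU hq
    rw [hψr q hq]
    simpa [h2] using h1
  obtain ⟨k, hk0, hk⟩ := A.exists_hasDerivAt_chart_orbit hψ hpψ (A.K_future p hp).1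
  -- The orbit of `p` stays in the horizon, so its `r`-th coordinate is constantly zero near `u =
  -- 0`. This forces the flow direction `a` to differ from `r`.
  have hkr : k r = 0 := by
    have h1 : HasDerivAt (fun u ↦ ψ (A.χ u p) r) (k r) 0 :=
      ((EuclideanSpace.proj (𝕜 := ℝ) r).hasFDerivAt.comp_hasDerivAt (0 : ℝ) hk :)
    refine h1.unique ((hasDerivAt_const (0 : ℝ) (0 : ℝ)).congr_of_eventuallyEq ?_)
    have hmem : A.χ 0 p ∈ ψ.source := by rwa [A.χ_zero]
    filter_upwards [(A.continuous_orbit p).continuousAt.eventually_mem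
      (ψ.open_source.mem_nhds hmem)] with u hu
    exact (hN _ hu).1 ((A.χ_mem_N_iff u p).2 hp)
  obtain ⟨a, ha⟩ : ∃ a, k a ≠ 0 := by
    by_contra! h
    exact hk0 (by ext i; exact h i)
  have har : a ≠ r := fun h ↦ ha (h ▸ hkr)
  obtain ⟨φ, hφ, hpφ, hy⟩ := exists_chart_flow A.χ_smooth A.χ_zero hψ hpψ hk ha
  refine ⟨φ, hφ, a, r, har, hpφ, fun y hyt ↦ ?_, fun y hyt u hyu ↦ ?_⟩
  -- The flow preserves the horizon, and the slice point has `r`-th coordinate `(ψ p) r + y r = y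
  -- r`.
  · obtain ⟨h1, h2⟩ := hy y hyt
    rw [h2, A.χ_mem_N_iff, hN _ (ψ.map_target h1), ψ.right_inv h1]
    simp [(hN p hpψ).1 hp, har.symm]
  · rw [(hy y hyt).2, (hy _ hyu).2, ← A.χ_add]
    congr 1
    · simp [add_comm]
    · congr 2
      simp only [PiLp.add_apply, PiLp.smul_apply, PiLp.single_apply, if_true,
        smul_eq_mul, mul_one, add_smul]
      abel

end Spacetime.ClassA

theorem fderiv_eq_sum_partialDeriv {n : ℕ} (F : EuclideanSpace ℝ (Fin n) → ℝ)
    (y v : EuclideanSpace ℝ (Fin n)) : fderiv ℝ F y v = ∑ j, v j * partialDeriv j F y := by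
  have hv : v = ∑ j, v j • EuclideanSpace.single j (1 : ℝ) := by
    ext i
    simp [Pi.single_apply]
  conv_lhs => rw [hv, map_sum]
  simp [partialDeriv]

/-- A function whose tangential derivatives vanish on the hyperplane `x_r = 0` is locally constant
there. -/
theorem eq_of_partialDeriv_eq_zero_on_hyperplane {n : ℕ} {F : EuclideanSpace ℝ (Fin n) → ℝ}
    {r : Fin n} {s : Set (EuclideanSpace ℝ (Fin n))} (hs : Convex ℝ s)
    (hF : ∀ y ∈ s, DifferentiableAt ℝ F y)
    (hd : ∀ y ∈ s, y r = 0 → ∀ j, j ≠ r → partialDeriv j F y = 0)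
    {x y : EuclideanSpace ℝ (Fin n)} (hx : x ∈ s) (hxr : x r = 0) (hy : y ∈ s) (hyr : y r = 0) :
    F y = F x := by
  -- The segment from `x` to `y` lies in the hyperplane and its direction has no `r` component, so
  -- only tangential derivatives enter.
  obtain ⟨z, hz, h⟩ := domain_mvt (fun w hw ↦ (hF w hw).hasFDerivAt.hasFDerivWithinAt) hs hx hy
  have hzs : z ∈ s := hs.segment_subset hx hy hz
  have hzr : z r = 0 := by
    obtain ⟨α, β, -, -, -, rfl⟩ := hz
    simp [hxr, hyr]
  rw [fderiv_eq_sum_partialDeriv, Finset.sum_eq_zero] at h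
  · linarith
  · intro j _
    by_cases hj : j = r
    · subst hj
      simp [hxr, hyr]
    · rw [hd z hzs hzr j hj, mul_zero]

/-! ### Horizon charts -/

namespace Spacetime.ClassA

variable {n : ℕ} {M : Type*} [TopologicalSpace M]
    [ChartedSpace (EuclideanSpace ℝ (Fin n)) M] [IsManifold (𝓡 n) ∞ M] {S : Spacetime n M}
    {Z : Type*} [TopologicalSpace Z]
    [ChartedSpace (EuclideanSpace ℝ (Fin (n - 2))) Z] [IsManifold (𝓡 (n - 2)) ∞ Z]
    (A : S.ClassA Z)

/-- Coordinates in which the horizon is `x^r = 0` and the Killing field is `∂/∂x^a`. -/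
structure IsHorizonChart (φ : OpenPartialHomeomorph M (EuclideanSpace ℝ (Fin n)))
    (a r : Fin n) : Prop where
  mem_maximalAtlas : φ ∈ IsManifold.maximalAtlas (𝓡 n) ∞ M
  adapted : S.g.AdaptedIn φ a r
  mem_N_iff : ∀ y ∈ φ.target, φ.symm y ∈ A.N ↔ y r = 0
  K_eq : ∀ y ∈ φ.target, A.K (φ.symm y) = coordVector φ a y

variable {A} {φ : OpenPartialHomeomorph M (EuclideanSpace ℝ (Fin n))} {a r : Fin n}

theorem hasMFDerivAt_symm_add (hφ : φ ∈ IsManifold.maximalAtlas (𝓡 n) ∞ M)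
    {y c : EuclideanSpace ℝ (Fin n)} (hyc : y + c ∈ φ.target) :
    HasMFDerivAt (𝓡 n) (𝓡 n) (fun x ↦ φ.symm (x + c)) y
      (mfderiv (𝓡 n) (𝓡 n) φ.symm (y + c)) := by
  have h1 : HasMFDerivAt (𝓡 n) (𝓡 n) (fun x : EuclideanSpace ℝ (Fin n) ↦ x + c) y
      (ContinuousLinearMap.id ℝ (EuclideanSpace ℝ (Fin n))) :=
    ((hasFDerivAt_id y).add_const c).hasMFDerivAt
  exact ((chart_mdifferentiable hφ).mdifferentiableAt_symm hyc).hasMFDerivAt.comp y h1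

/-- Both sides are the velocity at `u = 0` of the same curve, written once as a coordinate line and
once as an orbit. -/
theorem K_eq_coordVector (hφ : φ ∈ IsManifold.maximalAtlas (𝓡 n) ∞ M)
    (hflow : ∀ y ∈ φ.target, ∀ u : ℝ, y + u • EuclideanSpace.single a (1 : ℝ) ∈ φ.target →
      φ.symm (y + u • EuclideanSpace.single a (1 : ℝ)) = A.χ u (φ.symm y))
    {y : EuclideanSpace ℝ (Fin n)} (hy : y ∈ φ.target) :
    A.K (φ.symm y) = coordVector φ a y := by
  set ea : EuclideanSpace ℝ (Fin n) := EuclideanSpace.single a (1 : ℝ) with hea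
  have h1 : HasMFDerivAt 𝓘(ℝ, ℝ) (𝓡 n) (fun u : ℝ ↦ u • ea + y) 0
      ((1 : ℝ →L[ℝ] ℝ).smulRight ea) :=
    (((1 : ℝ →L[ℝ] ℝ).smulRight ea).hasFDerivAt.add_const y).hasMFDerivAt
  have hy0 : (0 : ℝ) • ea + y = y := by simp
  have h2 : HasMFDerivAt (𝓡 n) (𝓡 n) φ.symm ((0 : ℝ) • ea + y)
      (mfderiv (𝓡 n) (𝓡 n) φ.symm ((0 : ℝ) • ea + y)) :=
    ((chart_mdifferentiable hφ).mdifferentiableAt_symm (by rwa [hy0])).hasMFDerivAt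
  have h3 := h2.comp (0 : ℝ) h1
  have h4 : (φ.symm ∘ fun u : ℝ ↦ u • ea + y) =ᶠ[nhds 0] fun u ↦ A.χ u (φ.symm y) := by
    filter_upwards [eventually_line_mem φ.open_target hy a] with u hu
    rw [Function.comp_apply, add_comm, hflow y hy u hu]
  have h5 := hasMFDerivAt_unique h3 ((A.hasMFDerivAt_orbit (φ.symm y)).congr_of_eventuallyEq h4)
  have h6 : (A.K (A.χ 0 (φ.symm y)) : EuclideanSpace ℝ (Fin n)) =
      coordVector φ a ((0 : ℝ) • ea + y) := by
    have h7 := congrArg (fun L : ℝ →L[ℝ] EuclideanSpace ℝ (Fin n) ↦ L 1) h5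
    have h8 : (1 : ℝ →L[ℝ] ℝ).smulRight (A.K (A.χ 0 (φ.symm y))) 1 = A.K (A.χ 0 (φ.symm y)) :=
      one_smul ℝ (A.K (A.χ 0 (φ.symm y)))
    have h9 : (1 : ℝ →L[ℝ] ℝ).smulRight ea 1 = ea := one_smul ℝ ea
    rw [← h8]
    refine h7.symm.trans ?_
    change mfderiv (𝓡 n) (𝓡 n) φ.symm ((0 : ℝ) • ea + y) ((1 : ℝ →L[ℝ] ℝ).smulRight ea 1) = _
    rw [h9]
    rfl
  -- The base points agree only propositionally; generalizing them avoids a transport between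
  -- tangent spaces.
  have key : ∀ (q : M) (x : EuclideanSpace ℝ (Fin n)), q = φ.symm y → x = y →
      (A.K q : EuclideanSpace ℝ (Fin n)) = coordVector φ a x →
      A.K (φ.symm y) = coordVector φ a y := by
    rintro q x rfl rfl h
    exact h
  exact key _ _ (A.χ_zero _) hy0 h6

theorem mdifferentiable_χ (u : ℝ) : MDifferentiable (𝓡 n) (𝓡 n) (A.χ u) := by
  have h1 : ContMDiff (𝓡 n) (𝓘(ℝ, ℝ).prod (𝓡 n)) ∞ (fun p : M ↦ (u, p)) :=
    contMDiff_const.prodMk contMDiff_id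
  exact (A.χ_smooth.comp h1).mdifferentiable (by simp)

/-- The components of the metric are invariant under the isometries. -/
theorem components_translate (hφ : φ ∈ IsManifold.maximalAtlas (𝓡 n) ∞ M)
    (hflow : ∀ y ∈ φ.target, ∀ u : ℝ, y + u • EuclideanSpace.single a (1 : ℝ) ∈ φ.target →
      φ.symm (y + u • EuclideanSpace.single a (1 : ℝ)) = A.χ u (φ.symm y))
    {y : EuclideanSpace ℝ (Fin n)} (hy : y ∈ φ.target) {u : ℝ}
    (hu : y + u • EuclideanSpace.single a (1 : ℝ) ∈ φ.target) (i j : Fin n) :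
    components S.g.val φ i j (y + u • EuclideanSpace.single a (1 : ℝ)) =
      components S.g.val φ i j y := by
  set c : EuclideanSpace ℝ (Fin n) := u • EuclideanSpace.single a (1 : ℝ) with hc
  have h1 := hasMFDerivAt_symm_add hφ hu
  have h2 : HasMFDerivAt (𝓡 n) (𝓡 n) (A.χ u ∘ φ.symm) y
      ((mfderiv (𝓡 n) (𝓡 n) (A.χ u) (φ.symm y)).comp (mfderiv (𝓡 n) (𝓡 n) φ.symm y)) :=
    (A.mdifferentiable_χ u (φ.symm y)).hasMFDerivAt.comp y
      ((chart_mdifferentiable hφ).mdifferentiableAt_symm hy).hasMFDerivAt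
  have h3 : (fun x ↦ φ.symm (x + c)) =ᶠ[nhds y] A.χ u ∘ φ.symm := by
    have hcont : Continuous fun x : EuclideanSpace ℝ (Fin n) ↦ x + c := by fun_prop
    filter_upwards [φ.open_target.mem_nhds hy,
      hcont.continuousAt.eventually_mem (φ.open_target.mem_nhds hu)] with x hx hxc
    exact hflow x hx u hxc
  -- Differentiating the flow identity in the base point shows that `dχ_u` carries each coordinate
  -- vector to the one at the translated point; the isometry property finishes.
  have h4 := hasMFDerivAt_unique h1 (h2.congr_of_eventuallyEq h3)
  have h5 : ∀ i, (coordVector φ i (y + c) : EuclideanSpace ℝ (Fin n)) =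
      mfderiv (𝓡 n) (𝓡 n) (A.χ u) (φ.symm y) (coordVector φ i y) := fun i ↦
    congrArg (fun L : EuclideanSpace ℝ (Fin n) →L[ℝ] EuclideanSpace ℝ (Fin n) ↦
      L (EuclideanSpace.single i (1 : ℝ))) h4
  have key : ∀ (q q' : M) (v w v' w' : EuclideanSpace ℝ (Fin n)), q = q' → v = v' → w = w' →
      S.g.val q v w = S.g.val q' v' w' := by
    rintro q _ v w _ _ rfl rfl rfl
    rfl
  exact (key _ _ _ _ _ _ (hflow y hy u hu) (h5 i) (h5 j)).trans
    (A.χ_isometry u (φ.symm y) (coordVector φ i y) (coordVector φ j y))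

/-- The Killing field is normal to the horizon. -/
theorem val_K_coordVector (hφ : φ ∈ IsManifold.maximalAtlas (𝓡 n) ∞ M) (har : a ≠ r)
    (hN : ∀ y ∈ φ.target, φ.symm y ∈ A.N ↔ y r = 0)
    (hK : ∀ y ∈ φ.target, A.K (φ.symm y) = coordVector φ a y)
    {y : EuclideanSpace ℝ (Fin n)} (hy : y ∈ φ.target) (hyr : y r = 0) {j : Fin n} (hj : j ≠ r) :
    S.g.val (φ.symm y) (A.K (φ.symm y)) (coordVector φ j y) = 0 := by
  have hq : φ.symm y ∈ A.N := (hN y hy).2 hyr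
  obtain ⟨U, f, hU, hqU, hf, hNU, hdf⟩ := A.N_null _ hq
  obtain ⟨hdf0, hnull⟩ := hdf _ ⟨hq, hqU⟩
  have hW : IsOpen (φ.target ∩ φ.symm ⁻¹' U) := φ.isOpen_inter_preimage_symm hU
  have hyW : y ∈ φ.target ∩ φ.symm ⁻¹' U := ⟨hy, hqU⟩
  have hfd : MDifferentiableAt (𝓡 n) 𝓘(ℝ, ℝ) f (φ.symm y) :=
    (hf.contMDiffAt (hU.mem_nhds hqU)).mdifferentiableAt (by simp)
  have htan : ∀ j, j ≠ r → mvfderiv (𝓡 n) f (φ.symm y) (coordVector φ j y) = 0 := by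
    intro j hj
    rw [mvfderiv_coordVector hφ hy hfd, partialDeriv_congr_of_eqOn_hyperplane (H := fun _ ↦ 0) hj
      hW ?_ hyW hyr ?_ (differentiableAt_const _), partialDeriv_const]
    · intro x hx hxr
      have : φ.symm x ∈ A.N ∩ U := ⟨(hN x hx.1).2 hxr, hx.2⟩
      rw [hNU] at this
      exact this.2
    · exact ((contDiffOn_comp_symm hφ hf).contDiffAt (hW.mem_nhds hyW)).differentiableAt (by simp)
  have hgrad0 : S.g.grad f (φ.symm y) ≠ 0 := by
    intro h0
    apply hdf0
    ext w
    rw [← S.g.val_raise]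
    change S.g.val _ (S.g.grad f (φ.symm y)) w = _
    rw [h0]
    simp
  -- `K = ∂/∂x^a` is null and tangent, hence orthogonal to the null gradient of `f`, hence a
  -- multiple of it. The gradient is orthogonal to every tangential coordinate vector.
  obtain ⟨c, hc⟩ := S.g.exists_smul_of_orthogonal_null hgrad0 hnull (A.K_null _ hq).ge (by
    rw [LorentzMetric.grad, S.g.val_raise, hK y hy, htan a har])
  rw [hc, map_smul, smul_apply, LorentzMetric.grad, S.g.val_raise, htan j hj, smul_zero]

variable (A) in
theorem exists_isHorizonChart {p : M} (hp : p ∈ A.N) :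
    ∃ (φ : OpenPartialHomeomorph M (EuclideanSpace ℝ (Fin n))) (a r : Fin n),
      p ∈ φ.source ∧ A.IsHorizonChart φ a r := by
  obtain ⟨φ, hφ, a, r, har, hps, hN, hflow⟩ := A.exists_adapted_chart hp
  have hK : ∀ y ∈ φ.target, A.K (φ.symm y) = coordVector φ a y :=
    fun y hy ↦ K_eq_coordVector hφ hflow hy
  refine ⟨φ, a, r, hps, hφ, ⟨S.g.regularIn hφ, har, fun y hy i j ↦ ?_, fun y hy hyr j hj ↦ ?_⟩,
    hN, hK⟩
  · have hd := hasDerivAt_line (((S.g.contDiffOn_components hφ i j).contDiffAt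
      (φ.open_target.mem_nhds hy)).differentiableAt (by simp)) a
    refine hd.unique ((hasDerivAt_const (0 : ℝ) (components S.g.val φ i j y)).congr_of_eventuallyEq
      ?_)
    filter_upwards [eventually_line_mem φ.open_target hy a] with u hu
    exact components_translate hφ hflow hy hu i j
  · rw [components, ← hK y hy]
    exact val_K_coordVector hφ har hN hK hy hyr hj

variable (A) in
theorem mdifferentiable_norm_K :
    MDifferentiable (𝓡 n) 𝓘(ℝ, ℝ) (fun q ↦ S.g.val q (A.K q) (A.K q)) := by
  intro q
  have := ContMDiffAt.clm_bundle_apply₂ (F₁ := EuclideanSpace ℝ (Fin n))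
    (F₂ := EuclideanSpace ℝ (Fin n)) (F₃ := ℝ)
    (E₁ := fun p : M ↦ TangentSpace (𝓡 n) p) (E₂ := fun p : M ↦ TangentSpace (𝓡 n) p)
    (E₃ := fun _ ↦ ℝ) (S.g.smooth q) (A.K_smooth q) (A.K_smooth q)
  rw [Bundle.contMDiffAt_totalSpace] at this
  exact ContMDiffAt.mdifferentiableAt (n := ∞) this.2 (by simp)

/-! ### Surface gravity and the Einstein equations in a horizon chart -/

namespace IsHorizonChart

variable (h : A.IsHorizonChart φ a r)
include h

/-- With the index lowered this reads `½ ∂_j g_{aa} = -Γ^a_{aa} g_{aj}`. For `j ≠ r` both sides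
vanish on the horizon; for `j = r` it is the formula `Γ^a_{aa} = -½ ∂_r g_{aa} / g_{ar}` from
`christoffel_eq`. -/
theorem half_grad_norm_K {y : EuclideanSpace ℝ (Fin n)} (hy : y ∈ φ.target) (hyr : y r = 0) :
    (1 / 2 : ℝ) • S.g.grad (fun q ↦ S.g.val q (A.K q) (A.K q)) (φ.symm y) =
      -(S.g.christoffel φ a a a y • A.K (φ.symm y)) := by
  apply (S.g.lower_bijective _).1
  ext w
  obtain ⟨c, rfl⟩ := exists_sum_coordVector h.mem_maximalAtlas hy w
  rw [map_sum, map_sum]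
  refine Finset.sum_congr rfl fun j _ ↦
    (map_smul _ _ _).trans ((congrArg (c j • ·) ?_).trans (map_smul _ _ _).symm)
  have hcomp : partialDeriv j ((fun q ↦ S.g.val q (A.K q) (A.K q)) ∘ φ.symm) y =
      partialDeriv j (components S.g.val φ a a) y := by
    refine partialDeriv_congr_of_eqOn j φ.open_target (fun x hx ↦ ?_) hy
    rw [Function.comp_apply, h.K_eq x hx, components]
  rw [map_smul, smul_apply, LorentzMetric.grad, S.g.val_raise,
    mvfderiv_coordVector h.mem_maximalAtlas hy (A.mdifferentiable_norm_K _), hcomp, map_neg,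
    map_smul, neg_apply, smul_apply, h.K_eq y hy, smul_eq_mul, smul_eq_mul]
  change _ = -(_ * components S.g.val φ a j y)
  by_cases hj : j = r
  · subst hj
    rw [h.adapted.christoffel_eq hy hyr h.adapted.ne, if_pos rfl,
      h.adapted.partialDeriv_eq_zero y hy]
    have := h.adapted.components_ne_zero hy hyr
    field_simp
    ring
  · rw [h.adapted.partialDeriv_normal hy hyr h.adapted.ne hj, h.adapted.normal y hy hyr j hj]
    ring

/-- Since `R_{aa}` and `g_{aa}` vanish on the horizon, the `aa` Einstein equation reduces to `8π
T_{aa} = 0`, which is what the energy condition needs. -/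
theorem contract_eq_smul {y : EuclideanSpace ℝ (Fin n)} (hy : y ∈ φ.target) (hyr : y r = 0) :
    ∃ c : ℝ, 0 ≤ c ∧
      S.contract A.T (φ.symm y) (A.K (φ.symm y)) = c • A.K (φ.symm y) := by
  have hq : φ.symm y ∈ A.N := (h.mem_N_iff y hy).2 hyr
  refine A.dominantEnergy.contract_eq_smul (A.K_future _ hq) (A.K_null _ hq) ?_
  have hE := A.einstein φ h.mem_maximalAtlas y hy a a
  rw [h.adapted.ricci_self hy hyr, h.adapted.normal y hy hyr a h.adapted.ne] at hE
  rw [h.K_eq y hy]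
  have hpi := Real.pi_pos
  have h0 : 8 * Real.pi * components A.T φ a a y = 0 := by rw [← hE]; ring
  exact (mul_eq_zero.1 h0).resolve_left (by positivity)

/-- Proportionality of `T^a_b K^b` to the normal `K` kills `T_{ja}` for tangential `j`. The Einstein
equation is read with indices `j a`, as the contraction uses the second slot of `T`; `ricci_comm`
then swaps them. -/
theorem ricci_eq_zero {y : EuclideanSpace ℝ (Fin n)} (hy : y ∈ φ.target) (hyr : y r = 0)
    {j : Fin n} (hj : j ≠ r) : S.g.ricci φ a j y = 0 := by
  obtain ⟨c, -, hc⟩ := h.contract_eq_smul hy hyr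
  have hT : components A.T φ j a y = 0 := by
    rw [components, ← h.K_eq y hy, ← val_contract, hc, map_smul, smul_apply, h.K_eq y hy]
    change c • components S.g.val φ a j y = 0
    rw [h.adapted.normal y hy hyr j hj, smul_zero]
  have hE := A.einstein φ h.mem_maximalAtlas y hy j a
  rw [hT, LorentzMetric.components_comm, h.adapted.normal y hy hyr j hj,
    h.adapted.ricci_comm hy] at hE
  linarith

theorem partialDeriv_surfaceGravity {y : EuclideanSpace ℝ (Fin n)} (hy : y ∈ φ.target)
    (hyr : y r = 0) {j : Fin n} (hj : j ≠ r) :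
    partialDeriv j (S.g.christoffel φ a a a) y = 0 := by
  have h1 := h.adapted.ricci_eq hy hyr hj
  rw [h.ricci_eq_zero hy hyr hj] at h1
  linarith

theorem surfaceGravity_eq {κ : A.N → ℝ} (hκ : A.IsSurfaceGravity κ)
    {y : EuclideanSpace ℝ (Fin n)} (hy : y ∈ φ.target) (hN : φ.symm y ∈ A.N) :
    κ ⟨φ.symm y, hN⟩ = S.g.christoffel φ a a a y := by
  have h1 := hκ ⟨φ.symm y, hN⟩
  rw [h.half_grad_norm_K hy ((h.mem_N_iff y hy).1 hN), neg_inj] at h1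
  exact (smul_left_injective ℝ (A.K_future _ hN).1 h1).symm

end IsHorizonChart

/-! ### From charts to the whole horizon -/

variable (A) in
theorem exists_surfaceGravity {p : M} (hp : p ∈ A.N) :
    ∃ κ : ℝ, (1 / 2 : ℝ) • S.g.grad (fun q ↦ S.g.val q (A.K q) (A.K q)) p = -(κ • A.K p) := by
  obtain ⟨φ, a, r, hps, h⟩ := A.exists_isHorizonChart hp
  have hy := φ.map_source hps
  have hsymm := φ.left_inv hps
  have hyr : φ p r = 0 := (h.mem_N_iff _ hy).1 (by rwa [hsymm])
  have := h.half_grad_norm_K hy hyr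
  rw [hsymm] at this
  exact ⟨_, this⟩

theorem isLocallyConstant_surfaceGravity {κ : A.N → ℝ} (hκ : A.IsSurfaceGravity κ) :
    IsLocallyConstant κ := by
  rw [IsLocallyConstant.iff_eventually_eq]
  rintro ⟨p, hp⟩
  obtain ⟨φ, a, r, hps, h⟩ := A.exists_isHorizonChart hp
  have hκφ : ∀ q : A.N, (q : M) ∈ φ.source → κ q = S.g.christoffel φ a a a (φ q) := by
    rintro ⟨q, hq⟩ hqs
    have hsymm := φ.left_inv hqs
    have hN : φ.symm (φ q) ∈ A.N := by rwa [hsymm]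
    rw [← h.surfaceGravity_eq hκ (φ.map_source hqs) hN]
    congr 1
    exact Subtype.ext hsymm.symm
  have hr : ∀ q ∈ A.N, q ∈ φ.source → φ q r = 0 := fun q hq hqs ↦
    (h.mem_N_iff _ (φ.map_source hqs)).1 (by rwa [φ.left_inv hqs])
  -- A coordinate ball is convex, so any two of its horizon points are joined by a segment inside
  -- the horizon.
  obtain ⟨ε, hε, hball⟩ := Metric.isOpen_iff.1 φ.open_target _ (φ.map_source hps)
  have hnhds : φ.source ∩ φ ⁻¹' Metric.ball (φ p) ε ∈ nhds p :=
    Filter.inter_mem (φ.open_source.mem_nhds hps)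
      ((φ.continuousAt hps).preimage_mem_nhds (Metric.ball_mem_nhds _ hε))
  filter_upwards [continuous_subtype_val.continuousAt.preimage_mem_nhds
    (x := (⟨p, hp⟩ : A.N)) hnhds] with q hq
  rw [hκφ q hq.1, hκφ ⟨p, hp⟩ hps]
  exact eq_of_partialDeriv_eq_zero_on_hyperplane (convex_ball (φ p) ε)
    (fun y hy ↦ LorentzMetric.differentiableAt_of_mem_target
      (h.adapted.smooth_christoffel a a a) (hball hy))
    (fun y hy hyr j hj ↦ h.partialDeriv_surfaceGravity (hball hy) hyr hj)
    (Metric.mem_ball_self hε) (hr p hp hps) hq.2 (hr q q.2 hq.1)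

end Spacetime.ClassA

theorem lemma4p2 {n : ℕ} (hn : 3 ≤ n) {M : Type*} [TopologicalSpace M] [T2Space M]
    [ParacompactSpace M] [ConnectedSpace M] [ChartedSpace (EuclideanSpace ℝ (Fin n)) M]
    [IsManifold (𝓡 n) ∞ M] {Z : Type*} [TopologicalSpace Z]
    [ChartedSpace (EuclideanSpace ℝ (Fin (n - 2))) Z] [IsManifold (𝓡 (n - 2)) ∞ Z]
    (S : Spacetime n M) (A : S.ClassA Z) :
    (∃! κ : A.N → ℝ, A.IsSurfaceGravity κ) ∧
    (∀ κ : A.N → ℝ, A.IsSurfaceGravity κ → ∃ κ₀ : ℝ, ∀ p : A.N, κ p = κ₀) ∧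
    (∀ p ∈ A.N, ∃ φ : ℝ, 0 ≤ φ ∧ S.contract A.T p (A.K p) = φ • A.K p) := by
  refine ⟨?_, fun κ hκ ↦ ?_, fun p hp ↦ ?_⟩
  · choose κ hκ using fun p : A.N ↦ A.exists_surfaceGravity p.2
    refine ⟨κ, hκ, fun κ' hκ' ↦ funext fun p ↦ ?_⟩
    have h1 := hκ' p
    rw [hκ p, neg_inj] at h1
    exact (smul_left_injective ℝ (A.K_future _ p.2).1 h1).symm
  · have : PreconnectedSpace A.N := isPreconnected_iff_preconnectedSpace.1
      A.N_connected.isPreconnected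
    obtain ⟨p₀, hp₀⟩ := A.N_connected.nonempty
    exact ⟨κ ⟨p₀, hp₀⟩, fun p ↦
      (Spacetime.ClassA.isLocallyConstant_surfaceGravity hκ).apply_eq_of_preconnectedSpace _ _⟩
  · obtain ⟨φ, a, r, hps, h⟩ := A.exists_isHorizonChart hp
    have hy := φ.map_source hps
    have hsymm := φ.left_inv hps
    have := h.contract_eq_smul hy ((h.mem_N_iff _ hy).1 (by rwa [hsymm]))
    rwa [hsymm] at this
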